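/- **Problem and network.** Let $N$ agents and $M$ tasks be given, with arbitrary real profits $c_{im}$, consumptions $w_{im}$ and capacities $g_i$. Put $P_i=\{z_i\in\{0,1\}^M:\sum_m w_{im}z_{im}\le g_i\}$. The Generalized Assignment Problem (GAP) is $$\max\ \sum_{i=1}^N c_i^\top z_i\quad\text{subject to}\quad \sum_{i=1}^N z_i=\mathbf 1_M,\quad z_i\in P_i\ (i=1,\dots,N).$$ The agents communicate over digraphs $(\{1,\dots,N\},\mathcal E^t)$, $t\in\mathbb N$, that are $L$-strongly connected: $L\ge 1$, and for every $t$ the digraph with edge set $\bigcup_{\tau=t}^{t+L-1}\mathcal E^\tau$ is strongly connected. The in-neighbours of $i$ at time $t$ are the $j$ with $(j,i)\in\mathcal E^t$. **Master programs.** For a set $\Delta$ of branching constraints ($z_{im}=0$ or $z_{im}=1$), let $P_i^\Delta$ be the set of points of $P_i$ that satisfy them, and let $\mathcal{MP}(\Delta)$ be the linear program $$\max \sum_{i}\sum_{v\in P_i^\Delta}(c_i^\top v)\lambda_i^v\quad\text{s.t.}\quad \sum_i\sum_{v}v\,\lambda_i^v=\mathbf 1_M,\quad \sum_{v}\lambda_i^v=1\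 \ \forall i,\quad \lambda\ge 0,$$ to which $M+N$ artificial variables are added, one per constraint (with a unit column) and each with profit $-K$, where $K$ is the big-M constant. A basis is a set of $M+N$ linearly independent columns. The optimal basis of the program restricted to a set of columns is the one associated with the lexicographically minimal optimal solution for a fixed common order of the columns, under the lexicographic perturbation $\mathbf 1+(\varepsilon,\varepsilon^2,\dots,\varepsilon^{M+N})$ of the right-hand side, for all sufficiently small $\varepsilon>0$. **Distributed Branch-and-Price algorithm.** Agent $i$ keeps a basis $B_i^t$, a label $\ell_i^t$, an incumbent $(J_i^t,z_{[i]}^t)$, a set of open problems (its tree), and the set $\Delta_i^t$ of branching constraints of its current problem. At $t=0$ the basis consists of the artificial columns, the label is $0$, $J_i^0=-\infty$, the tree is empty, and $\Delta_i^0=\emptyset$. In round $t$ an agent that has not halted receives $B_j^t,\ell_j^t$ from its in-neighbours $j$, and then acts as follows. *Case 1: all received labels are at most $\ell_i^t$.* The agent finds the optimal basis $B$ of the program restricted to the artificial columns and those columns of $B_i^t$ and of the received bases that satisfy $\Delta_i^t$. It takes the dual solution $(\pi,\mu)$ of $B$, and a maximizer $v$ of $(c_i-\pi)^\top z_i$ over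 $P_i^{\Delta_i^t}$ (no column is generated if this set is empty). If $(c_i-\pi)^\top v-\mu_i>0$, it replaces $B$ by the optimal basis for $B$ together with the column of $v$. It sets $B_i^{t+1}=B$ and changes nothing else, except that it goes to Case 2 with this basis if the basis has now been unchanged for $2NL+1$ consecutive rounds on the current problem. *Case 2: some received label exceeds $\ell_i^t$ (then the agent uses $B_i^t$), or the test in Case 1 succeeded.* The agent increases its label by $1$, and computes the basic solution of its basis, its value $J^{LP}$, and the point $z^{LP}$ with $z_i^{LP}=\sum_v\lambda_i^v v$. If an artificial variable is nonzero, or $J^{LP}<J_i^t$, the problem is pruned. Otherwise, if $z^{LP}\in\{0,1\}^{NM}$, the incumbent becomes $(J^{LP},z^{LP})$; and if $z^{LP}\notin\{0,1\}^{NM}$, the two problems obtained by adding $z_{im}=0$, respectively $z_{im}=1$, to $\Delta_i^t$, for some $(i,m)$ with $z^{LP}_{im}\notin\{0,1\}$, are added to the tree. If the tree is empty the agent halts: its state no longer changes, and it keeps sending its last basis and label. Otherwise it extracts a problem from the tree, and starts it from the optimal basis for the artificial columns and those columns of its own basis and of the bases received in this round that satisfy the new branching constraints. The choice of branching variables, the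 choice of the next problem, and the order of the columns are arbitrary but common to all agents; each agent's choice among the maximizers of its pricing problem is arbitrary. **Theorem.** Suppose that the GAP is feasible. There is a constant $K_0$, depending only on the data $(c,w,g)$ of the GAP, such that for every $K\ge K_0$, every $L\ge1$, every $L$-strongly connected sequence of digraphs, and all choices of the above routines, the sequences $\{J_i^t,z_{[i]}^t\}_{t\ge0}$, $i=1,\dots,N$, generated by the Distributed Branch-and-Price algorithm agree after finitely many communication rounds on a common optimal solution: there are $\overline T\in\mathbb N$ and an optimal solution $z^\star$ of the GAP, with optimal value $J^\star$, such that $$J_i^t=J^\star\quad\text{and}\quad z_{[i]}^t=z^\star\qquad\text{for all } i\in\{1,\dots,N\}\text{ and all } t\ge\overline T .$$ -/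

import Mathlib

open Filter Topology
open scoped Classical

noncomputable section

namespace BnP

/-! ### The Generalized Assignment Problem -/

/-- Data of a Generalized Assignment Problem with `N` agents and `M` tasks: profits `c i m`,
resource consumptions `w i m` and capacities `g i`, all arbitrary reals. -/
structure GAP (N M : ℕ) where
  c : Fin N → Fin M → ℝ
  w : Fin N → Fin M → ℝ
  g : Fin N → ℝ

/-- All entries of `z` are `0` or `1`. -/
def IsBinary {N M : ℕ} (z : Fin N → Fin M → ℝ) : Prop :=
  ∀ i m, z i m = 0 ∨ z i m = 1

/-- The local constraint set `P_i = {z_i ∈ {0,1}^M | w_i · z_i ≤ g_i}`. -/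
def GAP.P {N M : ℕ} (gap : GAP N M) (i : Fin N) : Set (Fin M → ℝ) :=
  {y | (∀ m, y m = 0 ∨ y m = 1) ∧ ∑ m, gap.w i m * y m ≤ gap.g i}

/-- Feasibility for the assignment problem. -/
def GAP.IsFeasible {N M : ℕ} (gap : GAP N M) (z : Fin N → Fin M → ℝ) : Prop :=
  (∀ i, z i ∈ gap.P i) ∧ ∀ m, ∑ i, z i m = 1

/-- The total profit. -/
def GAP.value {N M : ℕ} (gap : GAP N M) (z : Fin N → Fin M → ℝ) : ℝ :=
  ∑ i, ∑ m, gap.c i m * z i m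

/-- `z` is an optimal solution of the assignment problem. -/
def GAP.IsOptimal {N M : ℕ} (gap : GAP N M) (z : Fin N → Fin M → ℝ) : Prop :=
  gap.IsFeasible z ∧ ∀ z', gap.IsFeasible z' → gap.value z' ≤ gap.value z

/-! ### The communication network -/

/-- `L ≥ 1`, and for every `t` the union of the edge sets at times `t, …, t + L - 1` is
strongly connected. -/
def LStronglyConnected {N : ℕ} (L : ℕ) (G : ℕ → Digraph (Fin N)) : Prop :=
  1 ≤ L ∧ ∀ t : ℕ, ∀ i j : Fin N,
    Relation.ReflTransGen (fun a b => ∃ τ, t ≤ τ ∧ τ < t + L ∧ (G τ).Adj a b) i j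

/-- The in-neighbours of agent `i` at time `t`. -/
def inNbr {N : ℕ} (G : ℕ → Digraph (Fin N)) (t : ℕ) (i : Fin N) : Finset (Fin N) :=
  Finset.univ.filter fun j => (G t).Adj j i

/-! ### Branching constraints -/

/-- A problem of the branching tree, given by its branching constraints: `(i, m, b)` stands for
the constraint `z_{i,m} = 1` if `b` is true, and `z_{i,m} = 0` otherwise. -/
abbrev Node (N M : ℕ) := Finset (Fin N × Fin M × Bool)

/-- The 0/1-vector encoded by `v`. -/
def bvec {M : ℕ} (v : Fin M → Bool) : Fin M → ℝ := fun m => if v m then 1 else 0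

/-- The binary vector `v` of agent `i` satisfies the branching constraints `Δ`. -/
def Satisfies {N M : ℕ} (Δ : Node N M) (i : Fin N) (v : Fin M → Bool) : Prop :=
  ∀ m b, (i, m, b) ∈ Δ → v m = b

/-- Membership in the set `P_i^Δ` of points of `P_i` that satisfy the branching constraints. -/
def GAP.InP {N M : ℕ} (gap : GAP N M) (Δ : Node N M) (i : Fin N) (v : Fin M → Bool) : Prop :=
  bvec v ∈ gap.P i ∧ Satisfies Δ i v

/-! ### Master programs and lexicographic linear programming -/

/-- Constraints of a master program: `Sum.inl m` is the assignment constraint of task `m`,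
`Sum.inr i` the convexity constraint of agent `i`. -/
abbrev Row (N M : ℕ) := Fin M ⊕ Fin N

/-- Columns of a master program: `Sum.inl (i, v)` is the column `[c_i·v, v, e_i]` of the point `v`
of agent `i`, and `Sum.inr r` is the artificial (big-M) column of constraint `r`. -/
abbrev Col (N M : ℕ) := (Fin N × (Fin M → Bool)) ⊕ Row N M

/-- Constraint coefficients of a column. -/
def colVec {N M : ℕ} : Col N M → Row N M → ℝ
  | Sum.inl iv, Sum.inl m => bvec iv.2 m
  | Sum.inl iv, Sum.inr j => if j = iv.1 then 1 else 0
  | Sum.inr r, r' => if r' = r then 1 else 0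

/-- Cost coefficient of a column (of a maximization problem), with big-M constant `K`. -/
def GAP.cost {N M : ℕ} (gap : GAP N M) (K : ℝ) : Col N M → ℝ
  | Sum.inl iv => ∑ m, gap.c iv.1 m * bvec iv.2 m
  | Sum.inr _ => -K

/-- The right-hand side `1 + (ε, ε², …, ε^(M+N))` of the constraints, perturbed as in the
lexicographic simplex method; `ε = 0` gives the right-hand side of the master program. -/
def rhs {N M : ℕ} (ε : ℝ) : Row N M → ℝ
  | Sum.inl m => 1 + ε ^ ((m : ℕ) + 1)
  | Sum.inr i => 1 + ε ^ (M + (i : ℕ) + 1)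

/-- Feasible points of the (perturbed) linear program restricted to the columns in `V`. -/
def LPFeasible {N M : ℕ} (ε : ℝ) (V : Finset (Col N M)) (x : Col N M → ℝ) : Prop :=
  (∀ a, 0 ≤ x a) ∧ (∀ a, a ∉ V → x a = 0) ∧ ∀ r, ∑ a, x a * colVec a r = rhs ε r

/-- Objective function of the linear program. -/
def GAP.lpValue {N M : ℕ} (gap : GAP N M) (K : ℝ) (x : Col N M → ℝ) : ℝ :=
  ∑ a, gap.cost K a * x a

/-- Lexicographic comparison, the columns being ordered by `rank`. -/
def LexLE {N M : ℕ} (rank : Col N M → ℕ) (x y : Col N M → ℝ) : Prop :=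
  x = y ∨ ∃ a, x a < y a ∧ ∀ a', rank a' < rank a → x a' = y a'

/-- `x` is the lexicographically minimal optimal solution of the linear program restricted
to `V`. -/
def GAP.IsLexOpt {N M : ℕ} (gap : GAP N M) (K : ℝ) (rank : Col N M → ℕ) (ε : ℝ)
    (V : Finset (Col N M)) (x : Col N M → ℝ) : Prop :=
  LPFeasible ε V x ∧ ∀ y, LPFeasible ε V y →
    gap.lpValue K y < gap.lpValue K x ∨ (gap.lpValue K y = gap.lpValue K x ∧ LexLE rank x y)

/-- A basis: `M + N` linearly independent columns. -/
def IsBasis {N M : ℕ} (B : Finset (Col N M)) : Prop :=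
  B.card = M + N ∧ LinearIndependent ℝ (fun a : B => colVec (a : Col N M))

/-- `B` is the basis associated with the lexicographically minimal optimal solution of the linear
program restricted to `V`, under the lexicographic perturbation of the right-hand side, i.e. for
all sufficiently small `ε > 0`. The perturbation makes this basis unique. -/
def GAP.IsOptBasis {N M : ℕ} (gap : GAP N M) (K : ℝ) (rank : Col N M → ℕ)
    (V B : Finset (Col N M)) : Prop :=
  B ⊆ V ∧ IsBasis B ∧
    ∀ᶠ ε : ℝ in 𝓝[>] 0, ∃ x, gap.IsLexOpt K rank ε V x ∧ ∀ a, a ∉ B → x a = 0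

/-- The optimal basis of the linear program restricted to the columns in `V`. -/
def GAP.optBasis {N M : ℕ} (gap : GAP N M) (K : ℝ) (rank : Col N M → ℕ)
    (V : Finset (Col N M)) : Finset (Col N M) :=
  Classical.epsilon fun B => gap.IsOptBasis K rank V B

/-- The primal basic solution of a basis, for the unperturbed right-hand side. -/
def basicSol {N M : ℕ} (B : Finset (Col N M)) : Col N M → ℝ :=
  Classical.epsilon fun x =>
    (∀ a, a ∉ B → x a = 0) ∧ ∀ r, ∑ a, x a * colVec a r = rhs 0 r

/-- The dual basic solution of a basis; its entries at `Sum.inl m` form `π`, those at `Sum.inr i`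
form `μ`. -/
def GAP.dualSol {N M : ℕ} (gap : GAP N M) (K : ℝ) (B : Finset (Col N M)) : Row N M → ℝ :=
  Classical.epsilon fun y => ∀ a ∈ B, ∑ r, y r * colVec a r = gap.cost K a

/-- The artificial columns; they form the initial big-M basis. -/
def artCols (N M : ℕ) : Finset (Col N M) := Finset.univ.image Sum.inr

/-- The columns in `V` that are columns of the master program with branching constraints `Δ`,
together with the artificial columns. -/
def rmpCols {N M : ℕ} (Δ : Node N M) (V : Finset (Col N M)) : Finset (Col N M) :=
  artCols N M ∪ V.filter fun a => ∃ i v, a = Sum.inl (i, v) ∧ Satisfies Δ i v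

/-- The point `z_i = ∑_v x_{(i,v)} v` recovered from a solution of a master program. -/
def recoverZ {N M : ℕ} (x : Col N M → ℝ) : Fin N → Fin M → ℝ :=
  fun i m => ∑ v : Fin M → Bool, x (Sum.inl (i, v)) * bvec v m

/-! ### The algorithm -/

/-- The routines that the algorithm leaves open; all of them but `price` are common to the agents.
`branchVar` and `extract` receive the label of the current problem, so that they may be any
strategies, depending on the whole history. -/
structure Routines {N M : ℕ} (gap : GAP N M) where
  /-- The order of the columns that defines the lexicographic order. -/
  rank : Col N M → ℕ
  rank_injective : Function.Injective rank
  /-- The solver of agent `i` for the knapsack problem `max d · v` over `P_i^Δ`. -/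
  price : Fin N → (Fin M → ℝ) → Node N M → (Fin M → Bool)
  price_spec : ∀ i d Δ, (∃ v, gap.InP Δ i v) →
    gap.InP Δ i (price i d Δ) ∧
      ∀ v, gap.InP Δ i v → ∑ m, d m * bvec v m ≤ ∑ m, d m * bvec (price i d Δ) m
  /-- The choice of a branching variable at a point that is not binary. -/
  branchVar : ℕ → {z : Fin N → Fin M → ℝ // ¬ IsBinary z} → Fin N × Fin M
  branchVar_spec : ∀ (ℓ : ℕ) (z : {z : Fin N → Fin M → ℝ // ¬ IsBinary z}),
    z.1 (branchVar ℓ z).1 (branchVar ℓ z).2 ≠ 0 ∧ z.1 (branchVar ℓ z).1 (branchVar ℓ z).2 ≠ 1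
  /-- The choice of the next problem among the open problems of the tree. -/
  extract : ℕ → Finset (Node N M) → Node N M
  extract_spec : ∀ ℓ T, T.Nonempty → extract ℓ T ∈ T

/-- The state of an agent. -/
structure AgentState (N M : ℕ) where
  /-- candidate basis -/
  basis : Finset (Col N M)
  /-- label of the problem that is being solved -/
  label : ℕ
  /-- incumbent cost -/
  Jinc : EReal
  /-- incumbent solution -/
  zinc : Fin N → Fin M → ℝ
  /-- problems of the local tree that have not been extracted yet -/
  tree : Finset (Node N M)
  /-- branching constraints of the problem that is being solved -/
  node : Node N M
  /-- number of consecutive rounds in which the basis has not changed on the current problem -/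
  count : ℕ
  /-- the agent has halted -/
  halted : Bool

/-- The initial state: big-M basis, incumbent cost `-∞`, and the root problem, which has no
branching constraints. -/
def AgentState.init (N M : ℕ) : AgentState N M where
  basis := artCols N M
  label := 0
  Jinc := ⊥
  zinc := 0
  tree := ∅
  node := ∅
  count := 0
  halted := false

/-- One round of column generation of agent `i` on the problem with branching constraints `Δ`,
started from a set `V` of columns: solve the restricted master program, solve the pricing problem
with the dual solution, and, if the new column has positive reduced cost, pivot it in. -/
def GAP.colGen {N M : ℕ} (gap : GAP N M) (R : Routines gap) (K : ℝ) (i : Fin N)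
    (Δ : Node N M) (V : Finset (Col N M)) : Finset (Col N M) :=
  let B := gap.optBasis K R.rank (rmpCols Δ V)
  let y := gap.dualSol K B
  let d : Fin M → ℝ := fun m => gap.c i m - y (Sum.inl m)
  let v := R.price i d Δ
  if gap.InP Δ i v ∧ 0 < ∑ m, d m * bvec v m - y (Sum.inr i) then
    gap.optBasis K R.rank (insert (Sum.inl (i, v)) B)
  else B

/-- Case 2, for an agent in state `s` whose final basis for the current problem is `B`, and which
has received the columns `V` in this round. If the artificial variables are not all zero at the
basic solution, the problem is infeasible, and is pruned. The first basis for the next problem is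
computed from the columns at hand that satisfy its branching constraints. -/
def GAP.finish {N M : ℕ} (gap : GAP N M) (R : Routines gap) (K : ℝ)
    (s : AgentState N M) (B V : Finset (Col N M)) : AgentState N M :=
  let x := basicSol B
  let J : EReal := (gap.lpValue K x : EReal)
  let z := recoverZ x
  let live : Prop := (∀ r, x (Sum.inr r) = 0) ∧ s.Jinc ≤ J
  let Jinc' : EReal := if live ∧ IsBinary z then J else s.Jinc
  let zinc' := if live ∧ IsBinary z then z else s.zinc
  let tree' : Finset (Node N M) :=
    if h : live ∧ ¬ IsBinary z then
      let im := R.branchVar s.label ⟨z, h.2⟩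
      s.tree ∪ {insert (im.1, im.2, false) s.node, insert (im.1, im.2, true) s.node}
    else s.tree
  if tree' = ∅ then
    { s with
      basis := B, label := s.label + 1, Jinc := Jinc', zinc := zinc', tree := ∅, halted := true }
  else
    let Δ := R.extract s.label tree'
    { basis := gap.optBasis K R.rank (rmpCols Δ (B ∪ V))
      label := s.label + 1
      Jinc := Jinc'
      zinc := zinc'
      tree := tree'.erase Δ
      node := Δ
      count := 0
      halted := false }

/-- One communication round of agent `i` at time `t`, when the agents are in the states `s`. -/
def GAP.step {N M : ℕ} (gap : GAP N M) (R : Routines gap) (K : ℝ) (L : ℕ)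
    (G : ℕ → Digraph (Fin N)) (t : ℕ) (s : Fin N → AgentState N M) (i : Fin N) :
    AgentState N M :=
  let V := (inNbr G t i).biUnion fun j => (s j).basis
  if (s i).halted then s i
  else if ∀ j ∈ inNbr G t i, (s j).label ≤ (s i).label then
    let B := gap.colGen R K i (s i).node ((s i).basis ∪ V)
    let n := if B = (s i).basis then (s i).count + 1 else 0
    if 2 * N * L + 1 ≤ n then gap.finish R K (s i) B V
    else { s i with basis := B, count := n }
  else gap.finish R K (s i) (s i).basis V

/-- The states of all agents after `t` communication rounds. -/
def GAP.run {N M : ℕ} (gap : GAP N M) (R : Routines gap) (K : ℝ) (L : ℕ)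
    (G : ℕ → Digraph (Fin N)) : ℕ → Fin N → AgentState N M
  | 0 => fun _ => AgentState.init N M
  | t + 1 => gap.step R K L G t (gap.run R K L G t)

end BnP

end

/-! The engine is nondegeneracy. Each entry of a basic solution indexed by its basis is a nonzero
polynomial in the perturbation ε, because every row carries its own power of ε. There are finitely
many bases, so one fixed value `genEps` already shows all the signs valid for small ε. A feasible
basis (`Good`) is then determined by its basic solution, and comparing these solutions by objective
and then lexicographically is a strict total order. `GAP.pot` is the position in that order, and the
optimal basis of a set of columns maximizes it over the feasible bases inside the set
(`GAP.pot_le_pot_optBasis`). Hence, on one problem, an agent's potential never falls, and after each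
round it is at least what its in-neighbours on that problem had before the round (`Mixed.step`).

Potentials are bounded integers, so bases settle and some agent finishes (`Starts.exists_label_gt`).
The first one to finish has kept its basis long enough for potentials to travel to every agent and
back (`spread`), so all agents hold the same basis, and column generation of every agent fixes it
(`Starts.consensus`). Each agent's pricing then certifies its own columns; together they make the
dual solution feasible for the whole master program, whose value bounds all feasible points of the
problem (`GAP.value_le_lpValue`).

Agents pass to the next problem at different times, but what they must share (`Core`) depends only
on the previous core and the common basis (`GAP.core_finish_congr`). A lagging agent keeps that
basis until it moves on, so it makes the same transition. The network therefore carries out one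
sequential branch and bound (`Starts.next`).

For the search itself, `Core.Valid` says that no feasible point better than the incumbent is lost;
it survives each transition (`Core.Valid.finish`), while a weight that drops to a third at each
child decreases strictly. The threshold for K comes from the finite set of feasible bases, which
does not depend on K (`GAP.eventually_bigM`). -/

noncomputable section

namespace BnP

section

variable {N M : ℕ}

/-! ### Linear algebra of bases -/

/-- The linear map sending a weighting of the columns to the weighted sum of the columns. -/
def colSum : (Col N M → ℝ) →ₗ[ℝ] (Row N M → ℝ) := Fintype.linearCombination ℝ colVec

theorem colSum_apply (x : Col N M → ℝ) (r : Row N M) :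
    colSum x r = ∑ a, x a * colVec a r := by
  simp [colSum, Fintype.linearCombination_apply]

theorem colSum_single (a : Col N M) : colSum (Pi.single a 1) = colVec a := by
  ext r
  simp [colSum_apply, Pi.single_apply]

theorem lpFeasible_iff {ε : ℝ} {V : Finset (Col N M)} {x : Col N M → ℝ} :
    LPFeasible ε V x ↔ (∀ a, 0 ≤ x a) ∧ (∀ a, a ∉ V → x a = 0) ∧ colSum x = rhs ε := by
  simp only [LPFeasible, funext_iff, colSum_apply]

theorem linearIndependent_colVec_iff (B : Finset (Col N M)) :
    LinearIndependent ℝ (fun a : B => colVec (a : Col N M)) ↔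
      ∀ x : Col N M → ℝ, (∀ a, a ∉ B → x a = 0) → colSum x = 0 → x = 0 := by
  have h : LinearIndependent ℝ (fun a : B => colVec (a : Col N M)) ↔
      LinearIndepOn ℝ colVec (B : Set (Col N M)) := Iff.rfl
  have key : ∀ x : Col N M → ℝ, (∀ a, a ∉ B → x a = 0) →
      colSum x = ∑ a ∈ B, x a • colVec a := by
    intro x hx
    rw [colSum, Fintype.linearCombination_apply]
    exact (Finset.sum_subset (Finset.subset_univ B) fun a _ ha => by simp [hx a ha]).symm
  rw [h, linearIndepOn_finset_iff]
  constructor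
  · intro H x hx h0
    rw [key x hx] at h0
    ext a
    by_cases ha : a ∈ B
    · exact H x h0 a ha
    · exact hx a ha
  · intro H f hf a ha
    have := H (fun a => if a ∈ B then f a else 0) (fun a ha => if_neg ha) (by
      rw [key _ fun a ha => if_neg ha, ← hf]
      exact Finset.sum_congr rfl fun a ha => by rw [if_pos ha])
    simpa [ha] using congrFun this a

theorem IsBasis.eq_of_colSum_eq {B : Finset (Col N M)} (hB : IsBasis B) {x y : Col N M → ℝ}
    (hx : ∀ a, a ∉ B → x a = 0) (hy : ∀ a, a ∉ B → y a = 0) (h : colSum x = colSum y) :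
    x = y := by
  refine sub_eq_zero.1 ((linearIndependent_colVec_iff B).1 hB.2 (x - y) (fun a ha => ?_) ?_)
  · simp [hx a ha, hy a ha]
  · rw [map_sub, h, sub_self]

/-- A basis has as many columns as there are rows, so the injectivity given by independence is
already bijectivity. -/
theorem IsBasis.exists_solution {B : Finset (Col N M)} (hB : IsBasis B) :
    ∃ X : (Row N M → ℝ) →ₗ[ℝ] (Col N M → ℝ),
      (∀ b a, a ∉ B → X b a = 0) ∧ ∀ b, colSum (X b) = b := by
  let E : (B → ℝ) →ₗ[ℝ] (Col N M → ℝ) :=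
    Function.ExtendByZero.linearMap ℝ (Subtype.val : B → Col N M)
  have hE0 : ∀ f a, a ∉ B → E f a = 0 := fun f a ha =>
    Function.extend_apply' _ _ _ fun ⟨b, hb⟩ => ha (hb ▸ b.2)
  have hE1 : ∀ f (a : B), E f a = f a := fun f a => Subtype.val_injective.extend_apply _ _ a
  have hinj : Function.Injective (colSum ∘ₗ E) := by
    intro f g hfg
    have := hB.eq_of_colSum_eq (hE0 f) (hE0 g) hfg
    ext a
    rw [← hE1 f, ← hE1 g, this]
  have hfin : Module.finrank ℝ (B → ℝ) = Module.finrank ℝ (Row N M → ℝ) := by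
    simp [hB.1]
  let e := LinearMap.linearEquivOfInjective (colSum ∘ₗ E) hinj hfin
  refine ⟨E ∘ₗ e.symm.toLinearMap, fun b a ha => hE0 _ a ha, fun b => ?_⟩
  exact e.apply_symm_apply b

/-- The basic solution of a basis, as a linear function of the right-hand side. -/
def sol (B : Finset (Col N M)) : (Row N M → ℝ) →ₗ[ℝ] (Col N M → ℝ) :=
  if hB : IsBasis B then hB.exists_solution.choose else 0

theorem sol_apply_of_notMem {B : Finset (Col N M)} (b : Row N M → ℝ) {a : Col N M}
    (ha : a ∉ B) : sol B b a = 0 := by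
  unfold sol
  split_ifs with hB
  · exact hB.exists_solution.choose_spec.1 b a ha
  · rfl

theorem IsBasis.colSum_sol {B : Finset (Col N M)} (hB : IsBasis B) (b : Row N M → ℝ) :
    colSum (sol B b) = b := by
  rw [sol, dif_pos hB]
  exact hB.exists_solution.choose_spec.2 b

theorem IsBasis.eq_sol {B : Finset (Col N M)} (hB : IsBasis B) {x : Col N M → ℝ}
    {b : Row N M → ℝ} (hx : ∀ a, a ∉ B → x a = 0) (h : colSum x = b) : x = sol B b :=
  hB.eq_of_colSum_eq hx (fun _ ha => sol_apply_of_notMem b ha) (h.trans (hB.colSum_sol b).symm)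

theorem IsBasis.sol_colVec {B : Finset (Col N M)} (hB : IsBasis B) {a : Col N M} (ha : a ∈ B) :
    sol B (colVec a) = Pi.single a 1 :=
  (hB.eq_sol (fun a' ha' => Pi.single_eq_of_ne (fun h : a' = a => ha' (h ▸ ha)) _)
    (colSum_single a)).symm

theorem sol_apply_eq_sum (B : Finset (Col N M)) (b : Row N M → ℝ) (a : Col N M) :
    sol B b a = ∑ r, b r * sol B (Pi.single r 1) a := by
  conv_lhs => rw [← Finset.univ_sum_single b]
  rw [map_sum, Finset.sum_apply]
  refine Finset.sum_congr rfl fun r _ => ?_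
  have : (Pi.single r (b r) : Row N M → ℝ) = b r • Pi.single r 1 := by
    rw [← Pi.single_smul]; simp
  rw [this, map_smul, Pi.smul_apply, smul_eq_mul]

theorem IsBasis.basicSol_eq {B : Finset (Col N M)} (hB : IsBasis B) :
    basicSol B = sol B (rhs 0) := by
  have h := Classical.epsilon_spec (p := fun x : Col N M → ℝ =>
    (∀ a, a ∉ B → x a = 0) ∧ ∀ r, ∑ a, x a * colVec a r = rhs 0 r)
    ⟨sol B (rhs 0), fun a ha => sol_apply_of_notMem _ ha, fun r => by
      rw [← colSum_apply, hB.colSum_sol]⟩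
  exact hB.eq_sol h.1 (funext fun r => (colSum_apply _ r).trans (h.2 r))

/-- The objective function of the linear program, as a linear map. -/
def GAP.objective (gap : GAP N M) (K : ℝ) : (Col N M → ℝ) →ₗ[ℝ] ℝ :=
  Fintype.linearCombination ℝ (gap.cost K)

theorem GAP.lpValue_eq (gap : GAP N M) (K : ℝ) (x : Col N M → ℝ) :
    gap.lpValue K x = gap.objective K x := by
  simp [GAP.lpValue, GAP.objective, Fintype.linearCombination_apply, mul_comm]

theorem GAP.dualSol_spec (gap : GAP N M) (K : ℝ) {B : Finset (Col N M)} (hB : IsBasis B) :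
    ∀ a ∈ B, ∑ r, gap.dualSol K B r * colVec a r = gap.cost K a := by
  refine Classical.epsilon_spec (p := fun y : Row N M → ℝ =>
    ∀ a ∈ B, ∑ r, y r * colVec a r = gap.cost K a)
    -- The multiplier of a row is the objective of the basic solution for the unit right-hand side
    -- in that row.
    ⟨fun r => gap.lpValue K (sol B (Pi.single r 1)), fun a ha => ?_⟩
  have h : ∀ a', sol B (colVec a) a' = ∑ r, colVec a r * sol B (Pi.single r 1) a' :=
    sol_apply_eq_sum B (colVec a)
  have h2 : gap.lpValue K (sol B (colVec a)) = gap.cost K a := by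
    rw [hB.sol_colVec ha]
    simp [GAP.lpValue, Pi.single_apply]
  rw [← h2]
  simp only [GAP.lpValue, h, Finset.sum_mul, Finset.mul_sum]
  rw [Finset.sum_comm]
  exact Finset.sum_congr rfl fun _ _ => Finset.sum_congr rfl fun _ _ => by ring

/-- Complementary slackness: the dual constraints are tight on the basis, and the basic solution
vanishes off it. -/
theorem GAP.lpValue_sol (gap : GAP N M) (K : ℝ) {B : Finset (Col N M)} (hB : IsBasis B)
    (b : Row N M → ℝ) : gap.lpValue K (sol B b) = ∑ r, gap.dualSol K B r * b r := by
  have h : ∀ a, gap.cost K a * sol B b a =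
      ∑ r, gap.dualSol K B r * (sol B b a * colVec a r) := by
    intro a
    by_cases ha : a ∈ B
    · rw [← gap.dualSol_spec K hB a ha, Finset.sum_mul]
      exact Finset.sum_congr rfl fun _ _ => by ring
    · simp [sol_apply_of_notMem b ha]
  simp only [GAP.lpValue, h]
  rw [Finset.sum_comm]
  refine Finset.sum_congr rfl fun r _ => ?_
  rw [← Finset.mul_sum, ← colSum_apply, hB.colSum_sol]

theorem colVec_nonneg (a : Col N M) (r : Row N M) : 0 ≤ colVec a r := by
  rcases a with ⟨i, v⟩ | r' <;> rcases r with m | j <;> simp only [colVec, bvec] <;>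
    split_ifs <;> norm_num

theorem exists_colVec_eq_one (a : Col N M) : ∃ r, colVec a r = 1 := by
  rcases a with ⟨i, v⟩ | r
  · exact ⟨Sum.inr i, by simp [colVec]⟩
  · exact ⟨r, by simp [colVec]⟩

/-- Columns are nonnegative and each contains a one, so the feasible region has no recession
direction. This is what makes every ratio test below succeed. -/
theorem exists_neg_of_colSum_eq_zero {d : Col N M → ℝ} (hd : d ≠ 0) (h : colSum d = 0) :
    ∃ a, d a < 0 := by
  by_contra! hn
  refine hd (funext fun a => ?_)
  obtain ⟨r, hr⟩ := exists_colVec_eq_one a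
  have h0 : ∑ a, d a * colVec a r = 0 := by rw [← colSum_apply, h]; rfl
  have := (Finset.sum_eq_zero_iff_of_nonneg fun a _ =>
    mul_nonneg (hn a) (colVec_nonneg a r)).1 h0 a (Finset.mem_univ a)
  simpa [hr] using this

theorem isBasis_artCols : IsBasis (artCols N M) := by
  refine ⟨?_, (linearIndependent_colVec_iff _).2 fun x hx h => ?_⟩
  · rw [artCols, Finset.card_image_of_injective _ Sum.inr_injective]
    simp
  · have hl : ∀ iv, x (Sum.inl iv) = 0 := fun iv => hx _ (by simp [artCols])
    ext a
    rcases a with iv | r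
    · exact hl iv
    · have := congrFun h r
      rw [colSum_apply] at this
      simpa [Fintype.sum_sum_type, hl, colVec] using this

/-- The artificial columns span, so any independent set extends to a full basis. -/
theorem exists_isBasis_superset {S : Finset (Col N M)}
    (hS : LinearIndependent ℝ (fun a : S => colVec (a : Col N M))) :
    ∃ B, S ⊆ B ∧ IsBasis B := by
  have hS' : LinearIndepOn ℝ colVec (S : Set (Col N M)) := hS
  obtain ⟨b, -, hSb, hspan, hb⟩ := exists_linearIndepOn_extension hS' (Set.subset_univ _)
  have hb' : LinearIndependent ℝ (fun a : b.toFinset => colVec (a : Col N M)) := by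
    have : LinearIndepOn ℝ colVec (b.toFinset : Set (Col N M)) := by rwa [Set.coe_toFinset]
    exact this
  refine ⟨b.toFinset, fun a ha => by simpa using hSb ha, ?_, hb'⟩
  have h1 := finrank_span_eq_card hb'
  have h2 : Submodule.span ℝ (Set.range fun a : b.toFinset => colVec (a : Col N M)) = ⊤ := by
    rw [eq_top_iff]
    rintro x -
    have hx : colSum (sol (artCols N M) x) = x := isBasis_artCols.colSum_sol x
    rw [← hx, colSum, Fintype.linearCombination_apply]
    refine Submodule.sum_mem _ fun a _ => Submodule.smul_mem _ _ ?_
    have := hspan ⟨a, Set.mem_univ a, rfl⟩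
    refine Submodule.span_mono ?_ this
    rintro _ ⟨a', ha', rfl⟩
    exact ⟨⟨a', by simpa using ha'⟩, rfl⟩
  rw [h2, finrank_top] at h1
  simpa using h1.symm

end

section

variable {N M : ℕ}

/-! ### The lexicographic order on points -/

/-- Moving along `d` increases the objective function, or keeps it and decreases the point
lexicographically. -/
def GAP.Improving (gap : GAP N M) (K : ℝ) (rank : Col N M → ℕ) (d : Col N M → ℝ) : Prop :=
  0 < gap.objective K d ∨
    gap.objective K d = 0 ∧ ∃ a, d a < 0 ∧ ∀ a', rank a' < rank a → d a' = 0

section Improving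

variable {gap : GAP N M} {K : ℝ} {rank : Col N M → ℕ} {d d' : Col N M → ℝ}

theorem GAP.not_improving_zero : ¬ gap.Improving K rank 0 := by
  simp [GAP.Improving]

theorem GAP.Improving.add (hr : Function.Injective rank) (h : gap.Improving K rank d)
    (h' : gap.Improving K rank d') :
    gap.Improving K rank (d + d') := by
  unfold GAP.Improving at *
  rw [map_add]
  rcases h with h | ⟨h, a, ha, hl⟩ <;> rcases h' with h' | ⟨h', a', ha', hl'⟩
  · left; linarith
  · left; linarith
  · left; linarith
  · refine Or.inr ⟨by rw [h, h', add_zero], ?_⟩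
    have key : ∀ b, rank b < rank a → rank b < rank a' → (d + d') b = 0 := fun b h1 h2 => by
      simp [hl b h1, hl' b h2]
    rcases lt_trichotomy (rank a) (rank a') with hra | hra | hra
    · exact ⟨a, by simpa [hl' a hra] using ha, fun b hb => key b hb (hb.trans hra)⟩
    · obtain rfl := hr hra
      exact ⟨a, by rw [Pi.add_apply]; linarith, fun b hb => key b hb hb⟩
    · exact ⟨a', by simpa [hl a' hra] using ha', fun b hb => key b (hb.trans hra) hb⟩

theorem GAP.Improving.smul (h : gap.Improving K rank d) {θ : ℝ} (hθ : 0 < θ) :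
    gap.Improving K rank (θ • d) := by
  unfold GAP.Improving at *
  rw [map_smul, smul_eq_mul]
  rcases h with h | ⟨h, a, ha, hl⟩
  · exact Or.inl (mul_pos hθ h)
  · refine Or.inr ⟨by rw [h, mul_zero], a, ?_, fun b hb => by simp [hl b hb]⟩
    exact mul_neg_of_pos_of_neg hθ ha

theorem GAP.Improving.of_smul {θ : ℝ} (hθ : 0 < θ) (h : gap.Improving K rank (θ • d)) :
    gap.Improving K rank d := by
  simpa [smul_smul, hθ.ne'] using h.smul (inv_pos.2 hθ)

theorem GAP.improving_or_neg (gap : GAP N M) (K : ℝ) (rank : Col N M → ℕ) (hd : d ≠ 0) :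
    gap.Improving K rank d ∨ gap.Improving K rank (-d) := by
  unfold GAP.Improving
  rw [map_neg]
  rcases lt_trichotomy (gap.objective K d) 0 with h | h | h
  · right; left; linarith
  · obtain ⟨b, hb⟩ := Function.ne_iff.1 hd
    obtain ⟨a, ha, hmin⟩ := Finset.exists_min_image (Finset.univ.filter fun a => d a ≠ 0) rank
      ⟨b, by simpa using hb⟩
    have hl : ∀ a', rank a' < rank a → d a' = 0 := fun a' h' => by
      by_contra h0
      exact absurd (hmin a' (by simpa using h0)) (not_le.2 h')
    have ha' : d a ≠ 0 := by simpa using ha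
    rcases lt_or_gt_of_ne ha' with h1 | h1
    · exact Or.inl (Or.inr ⟨h, a, h1, hl⟩)
    · exact Or.inr (Or.inr ⟨by rw [h, neg_zero], a, by simpa using h1,
        fun a' h' => by simp [hl a' h']⟩)
  · left; left; exact h

/-- The improving directions together with zero form a convex cone. -/
theorem GAP.sum_smul_improving {ι : Type*} (hr : Function.Injective rank) (s : Finset ι)
    (f : ι → ℝ) (v : ι → Col N M → ℝ)
    (hf : ∀ a ∈ s, 0 ≤ f a) (hv : ∀ a ∈ s, f a ≠ 0 → v a = 0 ∨ gap.Improving K rank (v a)) :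
    ∑ a ∈ s, f a • v a = 0 ∨ gap.Improving K rank (∑ a ∈ s, f a • v a) := by
  induction s using Finset.induction_on with
  | empty => simp
  | insert a s ha ih =>
    rw [Finset.sum_insert ha]
    have h1 := ih (fun b hb => hf b (Finset.mem_insert_of_mem hb))
      fun b hb => hv b (Finset.mem_insert_of_mem hb)
    have h2 : f a • v a = 0 ∨ gap.Improving K rank (f a • v a) := by
      by_cases h0 : f a = 0
      · simp [h0]
      · rcases hv a (Finset.mem_insert_self a s) h0 with h | h
        · simp [h]
        · exact Or.inr (h.smul (lt_of_le_of_ne (hf a (Finset.mem_insert_self a s)) (Ne.symm h0)))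
    rcases h2 with h2 | h2 <;> rcases h1 with h1 | h1
    · simp [h1, h2]
    · rw [h2, zero_add]; exact Or.inr h1
    · rw [h1, add_zero]; exact Or.inr h2
    · exact Or.inr (h2.add hr h1)

end Improving

theorem GAP.isLexOpt_iff {gap : GAP N M} {K : ℝ} {rank : Col N M → ℕ} {ε : ℝ}
    {V : Finset (Col N M)} {x : Col N M → ℝ} :
    gap.IsLexOpt K rank ε V x ↔ LPFeasible ε V x ∧
      ∀ y, LPFeasible ε V y → x = y ∨ gap.Improving K rank (x - y) := by
  refine and_congr_right fun _ => forall_congr' fun y => imp_congr_right fun _ => ?_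
  simp only [GAP.Improving, GAP.lpValue_eq, LexLE, map_sub, sub_pos, sub_eq_zero, Pi.sub_apply,
    sub_neg]
  constructor
  · rintro (h | ⟨h, h' | h'⟩)
    · exact Or.inr (Or.inl h)
    · exact Or.inl h'
    · exact Or.inr (Or.inr ⟨h.symm, h'⟩)
  · rintro (h | h | ⟨h, h'⟩)
    · exact Or.inr ⟨by rw [h], Or.inl h⟩
    · exact Or.inl h
    · exact Or.inr ⟨h.symm, Or.inr h'⟩

/-! ### Basic feasible solutions -/

/-- If the columns in the support are dependent, a kernel direction supported there can be oriented
so that it improves. Moving along it until an entry vanishes shrinks the support; induct on its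
size. -/
theorem GAP.exists_basic_le (gap : GAP N M) (K : ℝ) {rank : Col N M → ℕ}
    (hr : Function.Injective rank) {ε : ℝ} {V : Finset (Col N M)} {y : Col N M → ℝ}
    (hy : LPFeasible ε V y) :
    ∃ x, LPFeasible ε V x ∧ (x = y ∨ gap.Improving K rank (x - y)) ∧
      LinearIndependent ℝ (fun a : Finset.univ.filter fun a => x a ≠ 0 =>
        colVec (a : Col N M)) := by
  induction hn : (Finset.univ.filter fun a => y a ≠ 0).card using Nat.strong_induction_on
    generalizing y with
  | _ n ih =>
    by_cases hli : LinearIndependent ℝ (fun a : Finset.univ.filter fun a => y a ≠ 0 =>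
        colVec (a : Col N M))
    · exact ⟨y, hy, Or.inl rfl, hli⟩
    rw [linearIndependent_colVec_iff] at hli
    push Not at hli
    obtain ⟨d₀, hs₀, hc₀, h0₀⟩ := hli
    obtain ⟨d, hs, hc, h0, hd⟩ : ∃ d : Col N M → ℝ, (∀ a, y a = 0 → d a = 0) ∧ colSum d = 0 ∧
        d ≠ 0 ∧ gap.Improving K rank d := by
      have hs : ∀ a, y a = 0 → d₀ a = 0 := fun a ha => hs₀ a (by simp [ha])
      rcases gap.improving_or_neg K rank h0₀ with h | h
      · exact ⟨d₀, hs, hc₀, h0₀, h⟩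
      · exact ⟨-d₀, fun a ha => by simp [hs a ha], by rw [map_neg, hc₀, neg_zero],
          neg_ne_zero.2 h0₀, h⟩
    obtain ⟨b, hb⟩ := exists_neg_of_colSum_eq_zero h0 hc
    obtain ⟨a, ha, hmin⟩ := Finset.exists_min_image (Finset.univ.filter fun a => d a < 0)
      (fun a => y a / -d a) ⟨b, by simpa using hb⟩
    have hda : d a < 0 := by simpa using ha
    have hya : y a ≠ 0 := fun h => hda.ne (hs a h)
    obtain ⟨hy0, hyV, hyc⟩ := lpFeasible_iff.1 hy
    set θ := y a / -d a with hθ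
    have hθpos : 0 < θ := div_pos (lt_of_le_of_ne (hy0 a) hya.symm) (by linarith)
    have hxf : LPFeasible ε V (y + θ • d) := by
      refine lpFeasible_iff.2 ⟨fun a' => ?_, fun a' ha' => ?_, ?_⟩
      · rw [Pi.add_apply, Pi.smul_apply, smul_eq_mul]
        rcases le_or_gt 0 (d a') with h | h
        · have := mul_nonneg hθpos.le h
          have := hy0 a'
          linarith
        · have := hmin a' (by simpa using h)
          rw [le_div_iff₀ (by linarith)] at this
          linarith
      · simp [hyV a' ha', hs a' (hyV a' ha')]
      · rw [map_add, map_smul, hc, smul_zero, add_zero, hyc]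
    have hxa : (y + θ • d) a = 0 := by
      rw [Pi.add_apply, Pi.smul_apply, smul_eq_mul, hθ, div_neg, neg_mul,
        div_mul_cancel₀ _ hda.ne, add_neg_cancel]
    obtain ⟨x, hx, hxy, hxi⟩ := ih _ (by
      rw [← hn]
      refine Finset.card_lt_card (Finset.ssubset_iff_of_subset ?_ |>.2
        ⟨a, by simpa using hya, by simpa using hxa⟩)
      intro a'
      simp only [Finset.mem_filter, Finset.mem_univ, true_and]
      intro h h'
      exact h (by simp [h', hs a' h'])) hxf rfl
    refine ⟨x, hx, Or.inr ?_, hxi⟩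
    have h1 : gap.Improving K rank (θ • d) := hd.smul hθpos
    rcases hxy with rfl | h
    · simpa using h1
    · have := h.add hr h1
      rwa [show x - (y + θ • d) + θ • d = x - y by abel] at this

/-! ### A generic perturbation -/

/-- The exponent of the perturbation of a constraint. -/
def rowExp : Row N M → ℕ
  | Sum.inl m => (m : ℕ) + 1
  | Sum.inr i => M + (i : ℕ) + 1

theorem rhs_eq (ε : ℝ) (r : Row N M) : rhs ε r = 1 + ε ^ rowExp r := by
  rcases r with m | i <;> rfl

theorem rowExp_injective : Function.Injective (rowExp : Row N M → ℕ) := by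
  rintro (m | i) (m' | i') h <;> simp only [rowExp] at h
  · congr 1; ext; omega
  · have := m.2; omega
  · have := m'.2; omega
  · congr 1; ext; omega

theorem rowExp_pos (r : Row N M) : 0 < rowExp r := by
  rcases r with m | i <;> simp [rowExp]

/-- Near zero the sign is that of the lowest nonzero coefficient, seen by dividing out the largest
power of the variable. -/
theorem eventually_pos_or_neg_of_polynomial {p : Polynomial ℝ} (hp : p ≠ 0) :
    (∀ᶠ ε : ℝ in 𝓝[>] 0, 0 < p.eval ε) ∨ ∀ᶠ ε : ℝ in 𝓝[>] 0, p.eval ε < 0 := by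
  obtain ⟨q, hq, hdvd⟩ := p.exists_eq_pow_rootMultiplicity_mul_and_not_dvd hp 0
  rw [Polynomial.dvd_iff_isRoot, Polynomial.IsRoot] at hdvd
  have he : ∀ ε, p.eval ε = ε ^ p.rootMultiplicity 0 * q.eval ε := fun ε => by
    conv_lhs => rw [hq]
    simp
  have ht : Tendsto (fun ε => q.eval ε) (𝓝[>] 0) (𝓝 (q.eval 0)) :=
    (q.continuous.tendsto 0).mono_left nhdsWithin_le_nhds
  rcases lt_or_gt_of_ne hdvd with h | h
  · right
    filter_upwards [ht.eventually (gt_mem_nhds h), self_mem_nhdsWithin] with ε h1 h2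
    rw [he]
    exact mul_neg_of_pos_of_neg (pow_pos h2 _) h1
  · left
    filter_upwards [ht.eventually (lt_mem_nhds h), self_mem_nhdsWithin] with ε h1 h2
    rw [he]
    exact mul_pos (pow_pos h2 _) h1

/-- The exponents of the rows are positive and distinct, so the coefficients of this polynomial in ε
include the `a`-entries of the solutions for all unit right-hand sides. They cannot all vanish,
because by linearity the solution for the column `a` itself would then have `a`-entry 0 instead of
1. -/
theorem IsBasis.sol_rhs_eventually {B : Finset (Col N M)} (hB : IsBasis B) {a : Col N M}
    (ha : a ∈ B) : (∀ᶠ ε : ℝ in 𝓝[>] 0, 0 < sol B (rhs ε) a) ∨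
      ∀ᶠ ε : ℝ in 𝓝[>] 0, sol B (rhs ε) a < 0 := by
  let p : Polynomial ℝ := ∑ r : Row N M,
    Polynomial.C (sol B (Pi.single r 1) a) * (1 + Polynomial.X ^ rowExp r)
  have he : ∀ ε, sol B (rhs ε) a = p.eval ε := fun ε => by
    rw [sol_apply_eq_sum, Polynomial.eval_finsetSum]
    refine Finset.sum_congr rfl fun r _ => ?_
    simp [rhs_eq, mul_comm]
  simp only [he]
  refine eventually_pos_or_neg_of_polynomial fun hp => ?_
  have h0 : ∀ r, sol B (Pi.single r 1) a = 0 := fun r => by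
    have h1 : p.coeff (rowExp r) = sol B (Pi.single r 1) a := by
      simp only [p, Polynomial.finsetSum_coeff, Polynomial.coeff_C_mul, Polynomial.coeff_add,
        Polynomial.coeff_one, Polynomial.coeff_X_pow, (rowExp_pos r).ne', if_false, zero_add,
        rowExp_injective.eq_iff]
      simp
    rw [← h1, hp, Polynomial.coeff_zero]
  have h1 := sol_apply_eq_sum B (colVec a) a
  rw [hB.sol_colVec ha] at h1
  simp [h0] at h1

theorem exists_generic_perturbation (N M : ℕ) : ∃ ε : ℝ, 0 < ε ∧
    ∀ B : Finset (Col N M), IsBasis B → ∀ a ∈ B, sol B (rhs ε) a ≠ 0 ∧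
      (0 < sol B (rhs ε) a → ∀ᶠ ε' : ℝ in 𝓝[>] 0, 0 < sol B (rhs ε') a) ∧
      (sol B (rhs ε) a < 0 → ∀ᶠ ε' : ℝ in 𝓝[>] 0, sol B (rhs ε') a < 0) := by
  have h : ∀ᶠ ε : ℝ in 𝓝[>] 0, ∀ (B : Finset (Col N M)) (_ : IsBasis B) (a : Col N M) (_ : a ∈ B),
      sol B (rhs ε) a ≠ 0 ∧
      (0 < sol B (rhs ε) a → ∀ᶠ ε' : ℝ in 𝓝[>] 0, 0 < sol B (rhs ε') a) ∧
      (sol B (rhs ε) a < 0 → ∀ᶠ ε' : ℝ in 𝓝[>] 0, sol B (rhs ε') a < 0) := by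
    simp only [Filter.eventually_all]
    intro B hB a ha
    rcases hB.sol_rhs_eventually ha with h | h
    · filter_upwards [h] with ε hε using
        ⟨hε.ne', fun _ => h, fun h' => absurd hε (not_lt.2 h'.le)⟩
    · filter_upwards [h] with ε hε using
        ⟨hε.ne, fun h' => absurd hε (not_lt.2 h'.le), fun _ => h⟩
  obtain ⟨ε, h1, h2⟩ := (h.and self_mem_nhdsWithin).exists
  exact ⟨ε, h2, h1⟩

/-- A perturbation at which the signs of all basic solutions are the eventual ones. -/
def genEps (N M : ℕ) : ℝ := (exists_generic_perturbation N M).choose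

theorem genEps_pos : 0 < genEps N M := (exists_generic_perturbation N M).choose_spec.1

/-- The basic solution of a basis at the generic perturbation. -/
def bsol (B : Finset (Col N M)) : Col N M → ℝ := sol B (rhs (genEps N M))

/-- A basis that is feasible for the perturbed right-hand side. -/
def Good (B : Finset (Col N M)) : Prop := IsBasis B ∧ ∀ a, 0 ≤ bsol B a

theorem IsBasis.bsol_ne_zero {B : Finset (Col N M)} (hB : IsBasis B) {a : Col N M}
    (ha : a ∈ B) : bsol B a ≠ 0 :=
  ((exists_generic_perturbation N M).choose_spec.2 B hB a ha).1

theorem Good.bsol_pos {B : Finset (Col N M)} (hB : Good B) {a : Col N M} (ha : a ∈ B) :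
    0 < bsol B a :=
  lt_of_le_of_ne (hB.2 a) (hB.1.bsol_ne_zero ha).symm

theorem Good.eventually_pos {B : Finset (Col N M)} (hB : Good B) :
    ∀ᶠ ε : ℝ in 𝓝[>] 0, ∀ a ∈ B, 0 < sol B (rhs ε) a := by
  simp only [Filter.eventually_all]
  exact fun a ha => ((exists_generic_perturbation N M).choose_spec.2 B hB.1 a ha).2.1
    (hB.bsol_pos ha)

theorem IsBasis.good_of_eventually {B : Finset (Col N M)} (hB : IsBasis B)
    (h : ∀ᶠ ε : ℝ in 𝓝[>] 0, ∀ a ∈ B, 0 ≤ sol B (rhs ε) a) : Good B := by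
  refine ⟨hB, fun a => ?_⟩
  by_cases ha : a ∈ B
  · rcases (hB.bsol_ne_zero ha).lt_or_gt with h1 | h1
    · obtain ⟨ε, h2, h3⟩ :=
        (h.and (((exists_generic_perturbation N M).choose_spec.2 B hB a ha).2.2 h1)).exists
      exact absurd (h2 a ha) (not_le.2 h3)
    · exact h1.le
  · exact (sol_apply_of_notMem _ ha).ge

end

section

variable {N M : ℕ}

/-! ### Optimal bases -/

/-- The direction in which the basic solution of `B` moves when the column `a` enters. -/
def edgeDir (B : Finset (Col N M)) (a : Col N M) : Col N M → ℝ :=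
  Pi.single a 1 - sol B (colVec a)

theorem IsBasis.colSum_edgeDir {B : Finset (Col N M)} (hB : IsBasis B) (a : Col N M) :
    colSum (edgeDir B a) = 0 := by
  rw [edgeDir, map_sub, colSum_single, hB.colSum_sol, sub_self]

/-- The dual feasibility of a basis in the lexicographic sense. -/
def GAP.DualOpt (gap : GAP N M) (K : ℝ) (rank : Col N M → ℕ) (V B : Finset (Col N M)) : Prop :=
  ∀ a ∈ V, -edgeDir B a = 0 ∨ gap.Improving K rank (-edgeDir B a)

theorem lpFeasible_sol {ε : ℝ} {V B : Finset (Col N M)} (hB : IsBasis B) (hBV : B ⊆ V)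
    (h : ∀ a ∈ B, 0 ≤ sol B (rhs ε) a) : LPFeasible ε V (sol B (rhs ε)) := by
  refine lpFeasible_iff.2 ⟨fun a => ?_, fun a ha => sol_apply_of_notMem _ fun h' => ha (hBV h'),
    hB.colSum_sol _⟩
  by_cases ha : a ∈ B
  · exact h a ha
  · exact (sol_apply_of_notMem _ ha).ge

section

variable {gap : GAP N M} {K : ℝ} {rank : Col N M → ℕ} {V B : Finset (Col N M)}

/-- The difference between the basic solution and any feasible `y` is the combination of the
reversed edge directions with the nonnegative weights `y a`, so it lies in the cone of improving
directions. -/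
theorem GAP.DualOpt.isLexOpt (hr : Function.Injective rank) {ε : ℝ} (hB : IsBasis B)
    (hBV : B ⊆ V) (h : ∀ a ∈ B, 0 ≤ sol B (rhs ε) a) (hd : gap.DualOpt K rank V B) :
    gap.IsLexOpt K rank ε V (sol B (rhs ε)) := by
  refine isLexOpt_iff.2 ⟨lpFeasible_sol hB hBV h, fun y hy => ?_⟩
  obtain ⟨hy0, hyV, hyc⟩ := lpFeasible_iff.1 hy
  have hsum : ∑ a, y a • -edgeDir B a = sol B (rhs ε) - y := by
    have h1 : ∑ a, y a • (Pi.single a 1 : Col N M → ℝ) = y := by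
      ext b; simp [Finset.sum_apply, Pi.single_apply]
    have h2 : ∑ a, y a • sol B (colVec a) = sol B (rhs ε) := by
      rw [← hyc, colSum, Fintype.linearCombination_apply, map_sum]
      simp
    simp only [edgeDir, neg_sub, smul_sub, Finset.sum_sub_distrib, h1, h2]
  have := gap.sum_smul_improving (K := K) hr Finset.univ y (fun a => -edgeDir B a)
    (fun a _ => hy0 a) fun a _ ha => hd a (by_contra fun h' => ha (hyV a h'))
  rw [hsum, sub_eq_zero] at this
  exact this

/-- Strict positivity on the basis makes a short step along each edge feasible, and optimality then
says that undoing the step improves. -/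
theorem GAP.IsLexOpt.dualOpt {ε : ℝ} (hB : IsBasis B)
    (hBV : B ⊆ V) (h : ∀ a ∈ B, 0 < sol B (rhs ε) a)
    (hx : gap.IsLexOpt K rank ε V (sol B (rhs ε))) : gap.DualOpt K rank V B := by
  intro a ha
  set x := sol B (rhs ε) with hxdef
  obtain ⟨θ, hθ, hθpos⟩ : ∃ θ : ℝ, (∀ a', 0 ≤ x a' + θ * edgeDir B a a') ∧ 0 < θ := by
    have : ∀ᶠ θ : ℝ in 𝓝[>] 0, ∀ a', 0 ≤ x a' + θ * edgeDir B a a' := by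
      rw [Filter.eventually_all]
      intro a'
      by_cases ha' : a' ∈ B
      · have ht : Tendsto (fun θ : ℝ => x a' + θ * edgeDir B a a') (𝓝[>] 0)
            (𝓝 (x a' + 0 * edgeDir B a a')) :=
          (Continuous.tendsto (by fun_prop) 0).mono_left nhdsWithin_le_nhds
        rw [zero_mul, add_zero] at ht
        filter_upwards [ht.eventually (lt_mem_nhds (h a' ha'))] with θ hθ using hθ.le
      · filter_upwards [self_mem_nhdsWithin] with θ hθ
        have h1 : edgeDir B a a' = (Pi.single a 1 : Col N M → ℝ) a' := by
          simp [edgeDir, sol_apply_of_notMem _ ha']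
        have h2 : 0 ≤ (Pi.single a 1 : Col N M → ℝ) a' := by
          rw [Pi.single_apply]; split_ifs <;> norm_num
        rw [hxdef, sol_apply_of_notMem _ ha', h1, zero_add]
        exact mul_nonneg (le_of_lt hθ) h2
    exact (this.and self_mem_nhdsWithin).exists
  have hy : LPFeasible ε V (x + θ • edgeDir B a) := by
    refine lpFeasible_iff.2 ⟨hθ, fun a' ha' => ?_, ?_⟩
    · have h1 : a' ∉ B := fun h' => ha' (hBV h')
      have h2 : a' ≠ a := fun h' => ha' (h' ▸ ha)
      simp [hxdef, edgeDir, sol_apply_of_notMem _ h1, h2]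
    · rw [map_add, map_smul, hB.colSum_edgeDir, smul_zero, add_zero, hB.colSum_sol]
  rcases (isLexOpt_iff.1 hx).2 _ hy with h1 | h1
  · left
    have : θ • edgeDir B a = 0 := by simpa using h1.symm
    rw [(smul_eq_zero.1 this).resolve_left hθpos.ne', neg_zero]
  · right
    refine GAP.Improving.of_smul hθpos ?_
    rwa [show x - (x + θ • edgeDir B a) = θ • -edgeDir B a by rw [smul_neg]; abel] at h1

/-- Edge directions do not involve the right-hand side. The quantifier over small ε thus disappears:
it is absorbed into `Good` on the primal side, and the dual side never depended on ε. -/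
theorem GAP.isOptBasis_iff (hr : Function.Injective rank) :
    gap.IsOptBasis K rank V B ↔ B ⊆ V ∧ Good B ∧ gap.DualOpt K rank V B := by
  constructor
  · rintro ⟨hBV, hB, h⟩
    have h' : ∀ᶠ ε : ℝ in 𝓝[>] 0, gap.IsLexOpt K rank ε V (sol B (rhs ε)) := by
      filter_upwards [h] with ε ⟨x, hx, hx0⟩
      rwa [hB.eq_sol hx0 (lpFeasible_iff.1 hx.1).2.2] at hx
    have hg : Good B := hB.good_of_eventually (by
      filter_upwards [h'] with ε hε using fun a _ => hε.1.1 a)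
    obtain ⟨ε, h1, h2⟩ := (h'.and hg.eventually_pos).exists
    exact ⟨hBV, hg, h1.dualOpt hB hBV h2⟩
  · rintro ⟨hBV, hg, hd⟩
    refine ⟨hBV, hg.1, ?_⟩
    filter_upwards [hg.eventually_pos] with ε hε
    exact ⟨_, hd.isLexOpt hr hg.1 hBV fun a ha => (hε a ha).le,
      fun a ha => sol_apply_of_notMem _ ha⟩

end

/-! ### The potential that ranks feasible bases -/

theorem Good.eq_of_bsol_eq {B B' : Finset (Col N M)} (hB : Good B) (hB' : Good B')
    (h : bsol B = bsol B') : B = B' := by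
  ext a
  constructor
  · intro ha
    by_contra ha'
    exact hB.1.bsol_ne_zero ha (by rw [h]; exact sol_apply_of_notMem _ ha')
  · intro ha
    by_contra ha'
    exact hB'.1.bsol_ne_zero ha (by rw [← h]; exact sol_apply_of_notMem _ ha')

theorem Good.lpFeasible {B V : Finset (Col N M)} (hB : Good B) (hBV : B ⊆ V) :
    LPFeasible (genEps N M) V (bsol B) :=
  lpFeasible_sol hB.1 hBV fun a _ => hB.2 a

/-- The number of feasible bases that are worse than `B`. -/
def GAP.pot (gap : GAP N M) (K : ℝ) (rank : Col N M → ℕ) (B : Finset (Col N M)) : ℕ :=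
  (Finset.univ.filter fun B' : Finset (Col N M) =>
    Good B' ∧ gap.Improving K rank (bsol B - bsol B')).card

section

variable {gap : GAP N M} {K : ℝ} {rank : Col N M → ℕ} {V B B' : Finset (Col N M)}

theorem GAP.pot_lt_of_improving (hr : Function.Injective rank) (hB' : Good B')
    (h : gap.Improving K rank (bsol B - bsol B')) : gap.pot K rank B' < gap.pot K rank B := by
  refine Finset.card_lt_card (Finset.ssubset_iff_of_subset ?_ |>.2 ⟨B', ?_, ?_⟩)
  · intro B'' hB''
    simp only [Finset.mem_filter, Finset.mem_univ, true_and] at hB'' ⊢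
    refine ⟨hB''.1, ?_⟩
    have := h.add hr hB''.2
    rwa [sub_add_sub_cancel] at this
  · simpa using ⟨hB', h⟩
  · simp [GAP.not_improving_zero]

theorem GAP.improving_of_pot_le (hr : Function.Injective rank) (hB : Good B) (hB' : Good B')
    (h : gap.pot K rank B' ≤ gap.pot K rank B) :
    B = B' ∨ gap.Improving K rank (bsol B - bsol B') := by
  by_cases he : bsol B = bsol B'
  · exact Or.inl (hB.eq_of_bsol_eq hB' he)
  · rcases gap.improving_or_neg K rank (sub_ne_zero.2 he) with h1 | h1
    · exact Or.inr h1
    · rw [neg_sub] at h1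
      exact absurd (pot_lt_of_improving hr hB h1) (not_lt.2 h)

/-- Equality of integers forces equality of bases; consensus among the agents rests on this. -/
theorem GAP.eq_of_pot_eq (hr : Function.Injective rank) (hB : Good B) (hB' : Good B')
    (h : gap.pot K rank B = gap.pot K rank B') : B = B' := by
  rcases improving_of_pot_le hr hB hB' h.ge with h1 | h1
  · exact h1
  · exact absurd (pot_lt_of_improving hr hB' h1) (by omega)

/-- Take the feasible basis inside `V` of largest potential. It beats every feasible point, since
each point is dominated by a basic one, and by nondegeneracy the basis extending that one's support
is exactly the support, hence lies in `V`. -/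
theorem GAP.exists_isOptBasis (hr : Function.Injective rank) (hB : Good B) (hBV : B ⊆ V) :
    ∃ B', gap.IsOptBasis K rank V B' := by
  obtain ⟨B', hB', hmax⟩ := Finset.exists_max_image
    (Finset.univ.filter fun B : Finset (Col N M) => Good B ∧ B ⊆ V) (gap.pot K rank)
    ⟨B, by simpa using ⟨hB, hBV⟩⟩
  simp only [Finset.mem_filter, Finset.mem_univ, true_and] at hB' hmax
  refine ⟨B', (isOptBasis_iff hr).2 ⟨hB'.2, hB'.1, ?_⟩⟩
  refine GAP.IsLexOpt.dualOpt (ε := genEps N M) hB'.1.1 hB'.2 (fun a ha => hB'.1.bsol_pos ha)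
    (isLexOpt_iff.2 ⟨hB'.1.lpFeasible hB'.2, fun y hy => ?_⟩)
  obtain ⟨x, hx, hxy, hxi⟩ := gap.exists_basic_le K hr hy
  obtain ⟨B'', hS, hB''⟩ := exists_isBasis_superset hxi
  obtain ⟨hx0, hxV, hxc⟩ := lpFeasible_iff.1 hx
  have hxe : x = bsol B'' := hB''.eq_sol
    (fun a ha => by_contra fun h => ha (hS (by simpa using h))) hxc
  have hg : Good B'' := ⟨hB'', fun a => hxe ▸ hx0 a⟩
  have hB''V : B'' ⊆ V := fun a ha => by_contra fun h =>
    hB''.bsol_ne_zero ha (hxe ▸ hxV a h)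
  have h1 := improving_of_pot_le hr hB'.1 hg (hmax B'' ⟨hg, hB''V⟩)
  rw [hxe] at hxy
  change bsol B' = y ∨ gap.Improving K rank (bsol B' - y)
  rcases h1 with rfl | h1
  · exact hxy
  · rcases hxy with rfl | hxy
    · exact Or.inr h1
    · have := h1.add hr hxy
      rw [sub_add_sub_cancel] at this
      exact Or.inr this

theorem GAP.optBasis_spec (hr : Function.Injective rank) (hB : Good B) (hBV : B ⊆ V) :
    gap.optBasis K rank V ⊆ V ∧ Good (gap.optBasis K rank V) ∧
      gap.DualOpt K rank V (gap.optBasis K rank V) :=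
  (isOptBasis_iff hr).1 (Classical.epsilon_spec (gap.exists_isOptBasis hr hB hBV))

theorem GAP.pot_le_pot_optBasis (hr : Function.Injective rank) (hB : Good B) (hBV : B ⊆ V) :
    gap.pot K rank B ≤ gap.pot K rank (gap.optBasis K rank V) := by
  obtain ⟨h1, h2, h3⟩ := gap.optBasis_spec (K := K) hr hB hBV
  have h4 := h3.isLexOpt (ε := genEps N M) hr h2.1 h1 fun a _ => h2.2 a
  rcases (isLexOpt_iff.1 h4).2 _ (hB.lpFeasible hBV) with h5 | h5
  · rw [h2.eq_of_bsol_eq hB h5]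
  · exact (pot_lt_of_improving hr hB h5).le

theorem GAP.objective_edgeDir (hB : IsBasis B) (a : Col N M) :
    gap.objective K (edgeDir B a) =
      gap.cost K a - ∑ r, gap.dualSol K B r * colVec a r := by
  rw [edgeDir, map_sub, ← GAP.lpValue_eq, ← GAP.lpValue_eq, gap.lpValue_sol K hB]
  simp [GAP.lpValue, Pi.single_apply]

theorem GAP.DualOpt.reducedCost_nonpos (hB : IsBasis B) (h : gap.DualOpt K rank V B)
    {a : Col N M} (ha : a ∈ V) : gap.cost K a ≤ ∑ r, gap.dualSol K B r * colVec a r := by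
  have h1 := gap.objective_edgeDir (K := K) hB a
  rcases h a ha with h2 | h2
  · rw [neg_eq_zero.1 h2, map_zero] at h1
    linarith
  · have : 0 ≤ gap.objective K (-edgeDir B a) := by
      rcases h2 with h2 | h2
      · exact h2.le
      · exact h2.1.ge
    rw [map_neg, h1] at this
    linarith

end

/-- The unperturbed solution is the limit of the perturbed ones, which are eventually positive on
the basis. -/
theorem Good.basicSol_nonneg {B : Finset (Col N M)} (hB : Good B) (a : Col N M) :
    0 ≤ basicSol B a := by
  rw [hB.1.basicSol_eq]
  by_cases ha : a ∈ B
  · have hc : Continuous fun ε : ℝ => sol B (rhs ε) a := by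
      simp only [sol_apply_eq_sum B (rhs _), rhs_eq]
      fun_prop
    refine ge_of_tendsto ((hc.tendsto 0).mono_left (nhdsWithin_le_nhds (s := Set.Ioi 0))) ?_
    filter_upwards [hB.eventually_pos] with ε hε using (hε a ha).le
  · exact (sol_apply_of_notMem _ ha).ge

theorem good_artCols : Good (artCols N M) := by
  refine ⟨isBasis_artCols, fun a => ?_⟩
  let x : Col N M → ℝ := Sum.elim (fun _ => 0) (rhs (genEps N M))
  have : x = bsol (artCols N M) := by
    refine isBasis_artCols.eq_sol (fun a ha => ?_) ?_
    · rcases a with iv | r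
      · rfl
      · exact absurd (by simp [artCols]) ha
    · ext r
      simp [colSum_apply, x, Fintype.sum_sum_type, colVec]
  rw [← this]
  rcases a with iv | r
  · exact le_rfl
  · have := pow_pos (genEps_pos (N := N) (M := M)) (rowExp r)
    simp only [x, Sum.elim_inr, rhs_eq]
    linarith

end

section

variable {N M : ℕ}

/-! ### Column generation -/

/-- All points whose columns are in `V` belong to the local constraint sets. -/
def GAP.ColsFeasible (gap : GAP N M) (V : Finset (Col N M)) : Prop :=
  ∀ i v, Sum.inl (i, v) ∈ V → bvec v ∈ gap.P i

/-- `B` is a feasible basis of the master program with branching constraints `Δ`. -/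
def GAP.Adm (gap : GAP N M) (Δ : Node N M) (B : Finset (Col N M)) : Prop :=
  Good B ∧ ∀ i v, Sum.inl (i, v) ∈ B → gap.InP Δ i v

section

variable {gap : GAP N M} {R : Routines gap} {K : ℝ} {i : Fin N} {Δ : Node N M}
  {B V : Finset (Col N M)}

theorem GAP.Adm.colsFeasible (h : gap.Adm Δ B) : gap.ColsFeasible B :=
  fun i v hv => (h.2 i v hv).1

theorem GAP.Adm.subset_rmpCols (h : gap.Adm Δ B) (hBV : B ⊆ V) : B ⊆ rmpCols Δ V := by
  intro a ha
  rcases a with ⟨i, v⟩ | r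
  · exact Finset.mem_union_right _ (Finset.mem_filter.2 ⟨hBV ha, i, v, rfl, (h.2 i v ha).2⟩)
  · exact Finset.mem_union_left _ (by simp [artCols])

theorem GAP.inP_of_mem_rmpCols (hV : gap.ColsFeasible V) {v : Fin M → Bool}
    (h : Sum.inl (i, v) ∈ rmpCols Δ V) : gap.InP Δ i v := by
  rcases Finset.mem_union.1 h with h | h
  · simp [artCols] at h
  · obtain ⟨h1, i', v', he, h2⟩ := Finset.mem_filter.1 h
    obtain ⟨rfl, rfl⟩ := Prod.mk.inj (Sum.inl.inj he)
    exact ⟨hV _ _ h1, h2⟩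

/-- The artificial basis is always available and feasible, so an optimal basis exists whatever
columns are at hand. -/
theorem Routines.optBasis_rmpCols_spec (R : Routines gap) (K : ℝ) (Δ : Node N M)
    (V : Finset (Col N M)) :
    gap.optBasis K R.rank (rmpCols Δ V) ⊆ rmpCols Δ V ∧
      Good (gap.optBasis K R.rank (rmpCols Δ V)) ∧
      gap.DualOpt K R.rank (rmpCols Δ V) (gap.optBasis K R.rank (rmpCols Δ V)) :=
  GAP.optBasis_spec R.rank_injective good_artCols Finset.subset_union_left

theorem GAP.adm_optBasis_rmpCols (R : Routines gap) (K : ℝ) (hV : gap.ColsFeasible V) :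
    gap.Adm Δ (gap.optBasis K R.rank (rmpCols Δ V)) :=
  ⟨(R.optBasis_rmpCols_spec K Δ V).2.1, fun _ _ h =>
    inP_of_mem_rmpCols hV ((R.optBasis_rmpCols_spec K Δ V).1 h)⟩

theorem GAP.Adm.pot_le_optBasis_rmpCols (R : Routines gap) (K : ℝ) (h : gap.Adm Δ B)
    (hBV : B ⊆ V) :
    gap.pot K R.rank B ≤ gap.pot K R.rank (gap.optBasis K R.rank (rmpCols Δ V)) :=
  GAP.pot_le_pot_optBasis R.rank_injective h.1 (h.subset_rmpCols hBV)

theorem GAP.Adm.optBasis_insert (h : gap.Adm Δ B) {v : Fin M → Bool} (hv : gap.InP Δ i v) :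
    gap.Adm Δ (gap.optBasis K R.rank (insert (Sum.inl (i, v)) B)) := by
  have := gap.optBasis_spec (K := K) R.rank_injective h.1
    (Finset.subset_insert (Sum.inl (i, v)) B)
  refine ⟨this.2.1, fun i' v' h' => ?_⟩
  rcases Finset.mem_insert.1 (this.1 h') with h1 | h1
  · obtain ⟨rfl, rfl⟩ := Prod.mk.inj (Sum.inl.inj h1)
    exact hv
  · exact h.2 _ _ h1

theorem GAP.adm_colGen (R : Routines gap) (K : ℝ) (i : Fin N) (hV : gap.ColsFeasible V) :
    gap.Adm Δ (gap.colGen R K i Δ V) := by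
  have h := gap.adm_optBasis_rmpCols (Δ := Δ) R K hV
  simp only [GAP.colGen]
  split_ifs with hc
  · exact h.optBasis_insert hc.1
  · exact h

theorem GAP.pot_optBasis_le_colGen (R : Routines gap) (K : ℝ) (i : Fin N) (Δ : Node N M)
    (V : Finset (Col N M)) :
    gap.pot K R.rank (gap.optBasis K R.rank (rmpCols Δ V)) ≤
      gap.pot K R.rank (gap.colGen R K i Δ V) := by
  simp only [GAP.colGen]
  split_ifs with hc
  · exact GAP.pot_le_pot_optBasis R.rank_injective (R.optBasis_rmpCols_spec K Δ V).2.1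
      (Finset.subset_insert _ _)
  · exact le_rfl

theorem GAP.Adm.pot_le_colGen (R : Routines gap) (K : ℝ) (i : Fin N) (h : gap.Adm Δ B)
    (hBV : B ⊆ V) :
    gap.pot K R.rank B ≤ gap.pot K R.rank (gap.colGen R K i Δ V) :=
  (h.pot_le_optBasis_rmpCols R K hBV).trans (gap.pot_optBasis_le_colGen R K i Δ V)

theorem sum_dual_mul_colVec (y : Row N M → ℝ) (i : Fin N) (v : Fin M → Bool) :
    ∑ r, y r * colVec (Sum.inl (i, v)) r =
      ∑ m, y (Sum.inl m) * bvec v m + y (Sum.inr i) := by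
  simp [Fintype.sum_sum_type, colVec]

/-- Neither stage of a round lowers the potential, so a fixed point is fixed by both stages. The
pricing of agent `i` then finds no positive reduced cost, which bounds all of that agent's columns.
-/
theorem GAP.cost_le_of_colGen_eq (h : gap.Adm Δ B) (hfix : gap.colGen R K i Δ B = B)
    {v : Fin M → Bool} (hv : gap.InP Δ i v) :
    gap.cost K (Sum.inl (i, v)) ≤
      ∑ r, gap.dualSol K B r * colVec (Sum.inl (i, v)) r := by
  have hB1 : gap.optBasis K R.rank (rmpCols Δ B) = B := by
    have h1 := h.pot_le_optBasis_rmpCols R K subset_rfl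
    have h2 := gap.pot_optBasis_le_colGen R K i Δ B
    rw [hfix] at h2
    exact GAP.eq_of_pot_eq R.rank_injective (R.optBasis_rmpCols_spec K Δ B).2.1 h.1
      (le_antisymm h2 h1)
  have hred : ∀ v, gap.cost K (Sum.inl (i, v)) -
      ∑ r, gap.dualSol K B r * colVec (Sum.inl (i, v)) r =
      ∑ m, (gap.c i m - gap.dualSol K B (Sum.inl m)) * bvec v m -
        gap.dualSol K B (Sum.inr i) := by
    intro v
    rw [sum_dual_mul_colVec]
    simp only [GAP.cost, sub_mul, Finset.sum_sub_distrib]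
    ring
  obtain ⟨hp1, hp2⟩ := R.price_spec i (fun m => gap.c i m - gap.dualSol K B (Sum.inl m)) Δ
    ⟨v, hv⟩
  simp only [GAP.colGen, hB1] at hfix
  split_ifs at hfix with hc
  -- Had a column been priced in while `B` stayed optimal, its reduced cost would be nonpositive,
  -- against the pricing test.
  · have hd := (gap.optBasis_spec (K := K) R.rank_injective h.1 (Finset.subset_insert
      (Sum.inl (i, R.price i (fun m => gap.c i m - gap.dualSol K B (Sum.inl m)) Δ)) B)).2.2
    rw [hfix] at hd
    have h1 := hd.reducedCost_nonpos h.1.1 (Finset.mem_insert_self _ _)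
    have h2 := hc.2
    rw [← hred] at h2
    linarith
  · have h1 : ¬ _ := fun h1 => hc ⟨hp1, h1⟩
    have h2 := hp2 v hv
    have h3 := hred v
    rw [not_lt] at h1
    linarith

end

/-! ### Bounds from the master programs -/

/-- `z` satisfies the branching constraints `Δ`. -/
def NodeSat (Δ : Node N M) (z : Fin N → Fin M → ℝ) : Prop :=
  ∀ i m b, (i, m, b) ∈ Δ → z i m = if b then 1 else 0

theorem rhs_zero (r : Row N M) : rhs 0 r = 1 := by
  rw [rhs_eq, zero_pow (rowExp_pos r).ne', add_zero]

/-- Weak duality: add the dual constraints, one from each agent, at the columns that make up `z`.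
The assignment constraints turn the right side into the dual value, which equals the primal value of
the basis. -/
theorem GAP.value_le_lpValue {gap : GAP N M} {R : Routines gap} {K : ℝ} {Δ : Node N M}
    {B : Finset (Col N M)} (h : gap.Adm Δ B) (hfix : ∀ i, gap.colGen R K i Δ B = B)
    {z : Fin N → Fin M → ℝ} (hz : gap.IsFeasible z) (hΔ : NodeSat Δ z) :
    gap.value z ≤ gap.lpValue K (basicSol B) := by
  let u : Fin N → Fin M → Bool := fun i m => decide (z i m = 1)
  have hu : ∀ i, bvec (u i) = z i := fun i => by
    ext m
    rcases (hz.1 i).1 m with h0 | h0 <;> simp [bvec, u, h0]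
  have hin : ∀ i, gap.InP Δ i (u i) := fun i => by
    refine ⟨by rw [hu]; exact hz.1 i, fun m b hb => ?_⟩
    have := hΔ i m b hb
    cases b <;> simp_all [u]
  rw [h.1.1.basicSol_eq, gap.lpValue_sol K h.1.1]
  have hi : ∀ i, ∑ m, gap.c i m * z i m ≤
      ∑ m, gap.dualSol K B (Sum.inl m) * z i m + gap.dualSol K B (Sum.inr i) := fun i => by
    have := gap.cost_le_of_colGen_eq h (hfix i) (hin i)
    rwa [sum_dual_mul_colVec, GAP.cost, hu] at this
  refine (Finset.sum_le_sum fun i _ => hi i).trans_eq ?_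
  rw [Finset.sum_add_distrib, Finset.sum_comm]
  simp only [← Finset.mul_sum, hz.2, rhs_zero, Fintype.sum_sum_type, mul_one]

section

variable {gap : GAP N M} {K : ℝ} {Δ : Node N M} {B : Finset (Col N M)}

theorem IsBasis.colSum_basicSol (hB : IsBasis B) (r : Row N M) :
    ∑ a, basicSol B a * colVec a r = 1 := by
  rw [hB.basicSol_eq, ← colSum_apply, hB.colSum_sol, rhs_zero]

theorem IsBasis.sum_basicSol_inl (hB : IsBasis B) (hart : ∀ r, basicSol B (Sum.inr r) = 0)
    (i : Fin N) : ∑ v, basicSol B (Sum.inl (i, v)) = 1 := by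
  rw [← hB.colSum_basicSol (Sum.inr i)]
  simp only [Fintype.sum_sum_type, hart, colVec, Fintype.sum_prod_type, mul_ite, mul_one, mul_zero]
  rw [Finset.sum_comm]
  simp

theorem IsBasis.sum_recoverZ (hB : IsBasis B) (hart : ∀ r, basicSol B (Sum.inr r) = 0)
    (m : Fin M) : ∑ i, recoverZ (basicSol B) i m = 1 := by
  rw [← hB.colSum_basicSol (Sum.inl m)]
  simp [Fintype.sum_sum_type, hart, colVec, Fintype.sum_prod_type, recoverZ]

theorem GAP.lpValue_eq_value {x : Col N M → ℝ} (hart : ∀ r, x (Sum.inr r) = 0) :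
    gap.lpValue K x = gap.value (recoverZ x) := by
  simp only [GAP.lpValue, GAP.value, recoverZ, Fintype.sum_sum_type, hart, mul_zero,
    Finset.sum_const_zero, add_zero, Fintype.sum_prod_type, GAP.cost, Finset.mul_sum,
    Finset.sum_mul]
  refine Finset.sum_congr rfl fun i _ => ?_
  rw [Finset.sum_comm]
  exact Finset.sum_congr rfl fun _ _ => Finset.sum_congr rfl fun _ _ => by ring

theorem IsBasis.mem_of_basicSol_ne_zero (hB : IsBasis B) {a : Col N M}
    (h : basicSol B a ≠ 0) : a ∈ B := by
  by_contra ha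
  rw [hB.basicSol_eq, sol_apply_of_notMem _ ha] at h
  exact h rfl

theorem GAP.Adm.nodeSat_recoverZ (h : gap.Adm Δ B)
    (hart : ∀ r, basicSol B (Sum.inr r) = 0) : NodeSat Δ (recoverZ (basicSol B)) := by
  intro i m b hb
  have h1 : ∀ v, basicSol B (Sum.inl (i, v)) * bvec v m =
      basicSol B (Sum.inl (i, v)) * if b then 1 else 0 := fun v => by
    by_cases h0 : basicSol B (Sum.inl (i, v)) = 0
    · simp [h0]
    · have := (h.2 i v (h.1.1.mem_of_basicSol_ne_zero h0)).2 m b hb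
      simp [bvec, this]
  rw [recoverZ, Finset.sum_congr rfl fun v _ => h1 v, ← Finset.sum_mul,
    h.1.1.sum_basicSol_inl hart, one_mul]

/-- A binary vector that is a convex combination of 0/1 vectors equals each vector of positive
weight, so it is itself one of the columns. This matters because the local sets are not convex. -/
theorem GAP.Adm.isFeasible_recoverZ (h : gap.Adm Δ B)
    (hart : ∀ r, basicSol B (Sum.inr r) = 0) (hbin : IsBinary (recoverZ (basicSol B))) :
    gap.IsFeasible (recoverZ (basicSol B)) := by
  refine ⟨fun i => ?_, h.1.1.sum_recoverZ hart⟩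
  have hsum := h.1.1.sum_basicSol_inl hart i
  obtain ⟨v, -, hv⟩ : ∃ v ∈ Finset.univ, basicSol B (Sum.inl (i, v)) ≠ 0 := by
    refine Finset.exists_ne_zero_of_sum_ne_zero ?_
    rw [hsum]
    exact one_ne_zero
  have hP := (h.2 i v (h.1.1.mem_of_basicSol_ne_zero hv)).1
  suffices recoverZ (basicSol B) i = bvec v by rwa [this]
  have hb0 : ∀ (v : Fin M → Bool) m, 0 ≤ bvec v m := fun v m => by
    unfold bvec; split_ifs <;> norm_num
  have hb1 : ∀ (v : Fin M → Bool) m, 0 ≤ 1 - bvec v m := fun v m => by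
    unfold bvec; split_ifs <;> norm_num
  ext m
  rcases hbin i m with h0 | h0
  · have h1 := (Finset.sum_eq_zero_iff_of_nonneg fun v _ =>
      mul_nonneg (h.1.basicSol_nonneg (Sum.inl (i, v))) (hb0 v m)).1 h0 v (Finset.mem_univ v)
    rw [h0, (mul_eq_zero.1 h1).resolve_left hv]
  · have h2 : ∑ v, basicSol B (Sum.inl (i, v)) * (1 - bvec v m) = 0 := by
      simp only [mul_sub, mul_one, Finset.sum_sub_distrib, hsum]
      exact sub_eq_zero.2 h0.symm
    have h1 := (Finset.sum_eq_zero_iff_of_nonneg fun v _ =>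
      mul_nonneg (h.1.basicSol_nonneg (Sum.inl (i, v))) (hb1 v m)).1 h2 v (Finset.mem_univ v)
    rw [h0]
    linarith [(mul_eq_zero.1 h1).resolve_left hv]

end

/-- For a large big-M constant, a basic solution with a nonzero artificial variable is worse than
every feasible point. -/
theorem GAP.eventually_bigM (gap : GAP N M) : ∀ᶠ K : ℝ in atTop, ∀ B : Finset (Col N M), Good B →
    (¬ ∀ r, basicSol B (Sum.inr r) = 0) → ∀ z, gap.IsFeasible z →
      gap.lpValue K (basicSol B) < gap.value z := by
  -- There are finitely many bases, and neither `Good` nor `basicSol` involves `K`, so each basis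
  -- may be given its own threshold.
  simp only [Filter.eventually_all (ι := Finset (Col N M)), Filter.eventually_imp_distrib_left]
  intro B hB hart
  set x := basicSol B
  have hs : 0 < ∑ r : Row N M, x (Sum.inr r) := by
    push Not at hart
    obtain ⟨r, hr⟩ := hart
    exact Finset.sum_pos' (fun r _ => hB.basicSol_nonneg _)
      ⟨r, Finset.mem_univ r, lt_of_le_of_ne (hB.basicSol_nonneg _) (Ne.symm hr)⟩
  have hv : ∀ K, gap.lpValue K x = gap.lpValue 0 x - K * ∑ r : Row N M, x (Sum.inr r) := by
    intro K
    simp only [GAP.lpValue, Fintype.sum_sum_type, GAP.cost, neg_mul, Finset.sum_neg_distrib,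
      ← Finset.mul_sum]
    ring
  filter_upwards [eventually_gt_atTop
    ((gap.lpValue 0 x + ∑ i, ∑ m, |gap.c i m|) / ∑ r : Row N M, x (Sum.inr r))] with K hK z hz
  rw [div_lt_iff₀ hs] at hK
  have hz' : -∑ i, ∑ m, |gap.c i m| ≤ gap.value z := by
    simp only [GAP.value, ← Finset.sum_neg_distrib]
    refine Finset.sum_le_sum fun i _ => Finset.sum_le_sum fun m _ => ?_
    rcases (hz.1 i).1 m with h | h <;> rw [h]
    · simp
    · rw [mul_one]; exact neg_abs_le _
  rw [hv]
  linarith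

end

section

variable {N M : ℕ}

/-! ### Single rounds of the algorithm -/

/-- The part of the state of an agent on which the agents agree when they solve the same problem. -/
@[ext]
structure Core (N M : ℕ) where
  label : ℕ
  Jinc : EReal
  zinc : Fin N → Fin M → ℝ
  tree : Finset (Node N M)
  node : Node N M
  halted : Bool

/-- The shared part of a state. -/
def AgentState.core (s : AgentState N M) : Core N M :=
  ⟨s.label, s.Jinc, s.zinc, s.tree, s.node, s.halted⟩

/-- The problem solved by the basis `B` is not pruned. -/
def GAP.Live (gap : GAP N M) (K : ℝ) (s : AgentState N M) (B : Finset (Col N M)) : Prop :=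
  (∀ r, basicSol B (Sum.inr r) = 0) ∧ s.Jinc ≤ (gap.lpValue K (basicSol B) : EReal)

/-- The tree after the problem of the state `s` has been solved. -/
def GAP.finishTree (gap : GAP N M) (R : Routines gap) (K : ℝ) (s : AgentState N M)
    (B : Finset (Col N M)) : Finset (Node N M) :=
  if h : gap.Live K s B ∧ ¬ IsBinary (recoverZ (basicSol B)) then
    let im := R.branchVar s.label ⟨recoverZ (basicSol B), h.2⟩
    s.tree ∪ {insert (im.1, im.2, false) s.node, insert (im.1, im.2, true) s.node}
  else s.tree

section

variable {gap : GAP N M} {R : Routines gap} {K : ℝ} {L : ℕ} {G : ℕ → Digraph (Fin N)}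

theorem GAP.finish_eq (s : AgentState N M) (B V : Finset (Col N M)) :
    gap.finish R K s B V =
      if gap.finishTree R K s B = ∅ then
        { s with
          basis := B
          label := s.label + 1
          Jinc := if gap.Live K s B ∧ IsBinary (recoverZ (basicSol B)) then
            (gap.lpValue K (basicSol B) : EReal) else s.Jinc
          zinc := if gap.Live K s B ∧ IsBinary (recoverZ (basicSol B)) then
            recoverZ (basicSol B) else s.zinc
          tree := ∅
          halted := true }
      else
        { basis := gap.optBasis K R.rank
            (rmpCols (R.extract s.label (gap.finishTree R K s B)) (B ∪ V))
          label := s.label + 1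
          Jinc := if gap.Live K s B ∧ IsBinary (recoverZ (basicSol B)) then
            (gap.lpValue K (basicSol B) : EReal) else s.Jinc
          zinc := if gap.Live K s B ∧ IsBinary (recoverZ (basicSol B)) then
            recoverZ (basicSol B) else s.zinc
          tree := (gap.finishTree R K s B).erase (R.extract s.label (gap.finishTree R K s B))
          node := R.extract s.label (gap.finishTree R K s B)
          count := 0
          halted := false } := by
  unfold GAP.finish GAP.finishTree GAP.Live
  dsimp only
  congr!

/-- The received columns affect only the starting basis of the next problem, which is not part of
the core. -/
theorem GAP.core_finish_congr {s s' : AgentState N M} (h : s.core = s'.core)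
    (B V V' : Finset (Col N M)) :
    (gap.finish R K s B V).core = (gap.finish R K s' B V').core := by
  obtain ⟨b, l, J, z, T, Δ, c, ha⟩ := s
  obtain ⟨b', l', J', z', T', Δ', c', ha'⟩ := s'
  simp only [AgentState.core, Core.mk.injEq] at h
  obtain ⟨rfl, rfl, rfl, rfl, rfl, rfl⟩ := h
  simp only [GAP.finish_eq]
  have : gap.finishTree R K ⟨b, l, J, z, T, Δ, c, ha⟩ B =
      gap.finishTree R K ⟨b', l, J, z, T, Δ, c', ha⟩ B := rfl
  have hl : gap.Live K ⟨b, l, J, z, T, Δ, c, ha⟩ B =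
      gap.Live K ⟨b', l, J, z, T, Δ, c', ha⟩ B := rfl
  rw [this]
  simp only [hl]
  split_ifs <;> rfl

theorem GAP.finish_label (s : AgentState N M) (B V : Finset (Col N M)) :
    (gap.finish R K s B V).label = s.label + 1 := by
  rw [GAP.finish_eq]
  split_ifs <;> rfl

theorem GAP.finish_of_not_halted {s : AgentState N M} {B V : Finset (Col N M)}
    (h : (gap.finish R K s B V).halted = false) :
    (gap.finish R K s B V).basis =
      gap.optBasis K R.rank (rmpCols (gap.finish R K s B V).node (B ∪ V)) ∧
      (gap.finish R K s B V).count = 0 := by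
  rw [GAP.finish_eq] at h ⊢
  split_ifs at h ⊢ <;> simp_all

theorem GAP.finish_of_halted {s : AgentState N M} {B V : Finset (Col N M)}
    (h : (gap.finish R K s B V).halted = true) :
    (gap.finish R K s B V).basis = B ∧ (gap.finish R K s B V).node = s.node := by
  rw [GAP.finish_eq] at h ⊢
  split_ifs at h ⊢ <;> simp_all

/-- The columns received by agent `i` at time `t`. -/
def received (G : ℕ → Digraph (Fin N)) (t : ℕ) (s : Fin N → AgentState N M) (i : Fin N) :
    Finset (Col N M) :=
  (inNbr G t i).biUnion fun j => (s j).basis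

theorem basis_subset_received {t : ℕ} {s : Fin N → AgentState N M} {i j : Fin N}
    (h : (G t).Adj j i) : (s j).basis ⊆ received G t s i :=
  Finset.subset_biUnion_of_mem (fun j => (s j).basis) (by simpa [inNbr] using h)

theorem GAP.step_of_halted {t : ℕ} {s : Fin N → AgentState N M} {i : Fin N}
    (h : (s i).halted = true) : gap.step R K L G t s i = s i := by
  simp [GAP.step, h]

/-- A counter reset to zero cannot pass the test, so even an agent that stops by its own count
finishes with the basis it already held. The current round supplies the extra 1, hence the bound `2
* N * L` on the old counter. -/
theorem GAP.step_cases (gap : GAP N M) (R : Routines gap) (K : ℝ) (L : ℕ)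
    (G : ℕ → Digraph (Fin N)) (t : ℕ) (s : Fin N → AgentState N M) (i : Fin N)
    (h : (s i).halted = false) :
    ((∀ j, (G t).Adj j i → (s j).label ≤ (s i).label) ∧
      (gap.step R K L G t s i).count < 2 * N * L + 1 ∧
      (gap.step R K L G t s i).core = (s i).core ∧
      (gap.step R K L G t s i).basis =
        gap.colGen R K i (s i).node ((s i).basis ∪ received G t s i) ∧
      (gap.step R K L G t s i).count =
        if (gap.step R K L G t s i).basis = (s i).basis then (s i).count + 1 else 0) ∨
    ((∀ j, (G t).Adj j i → (s j).label ≤ (s i).label) ∧ 2 * N * L ≤ (s i).count ∧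
      gap.step R K L G t s i = gap.finish R K (s i) (s i).basis (received G t s i)) ∨
    ((∃ j, (G t).Adj j i ∧ (s i).label < (s j).label) ∧
      gap.step R K L G t s i = gap.finish R K (s i) (s i).basis (received G t s i)) := by
  have hn : ∀ j, j ∈ inNbr G t i ↔ (G t).Adj j i := fun j => by simp [inNbr]
  by_cases hl : ∀ j ∈ inNbr G t i, (s j).label ≤ (s i).label
  · set B := gap.colGen R K i (s i).node ((s i).basis ∪ received G t s i) with hB
    have hs : gap.step R K L G t s i =
        if 2 * N * L + 1 ≤ (if B = (s i).basis then (s i).count + 1 else 0) then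
          gap.finish R K (s i) B (received G t s i)
        else { s i with
          basis := B, count := if B = (s i).basis then (s i).count + 1 else 0 } := by
      simp only [GAP.step, h, Bool.false_eq_true, if_false]
      rw [if_pos hl]
      rfl
    have hl' : ∀ j, (G t).Adj j i → (s j).label ≤ (s i).label := fun j hj =>
      hl j ((hn j).2 hj)
    by_cases hc : 2 * N * L + 1 ≤ (if B = (s i).basis then (s i).count + 1 else 0)
    · rw [if_pos hc] at hs
      split_ifs at hc with hb
      · rw [hb] at hs
        exact Or.inr (Or.inl ⟨hl', by omega, hs⟩)
      · omega
    · rw [if_neg hc] at hs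
      rw [hs]
      exact Or.inl ⟨hl', not_le.1 hc, rfl, rfl, rfl⟩
  · have hs : gap.step R K L G t s i =
        gap.finish R K (s i) (s i).basis (received G t s i) := by
      simp only [GAP.step, h, Bool.false_eq_true, if_false]
      rw [if_neg hl]
      rfl
    push Not at hl
    obtain ⟨j, hj, hlt⟩ := hl
    exact Or.inr (Or.inr ⟨⟨j, (hn j).1 hj, hlt⟩, hs⟩)

/-! ### Invariants of single agents -/

theorem GAP.run_succ (t : ℕ) (i : Fin N) :
    gap.run R K L G (t + 1) i = gap.step R K L G t (gap.run R K L G t) i := rfl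

/-- Received bases may come from other problems, so only their membership in the local sets can be
used; the filter in `rmpCols` restores the branching constraints. -/
theorem GAP.adm_run (gap : GAP N M) (R : Routines gap) (K : ℝ) (L : ℕ)
    (G : ℕ → Digraph (Fin N)) (t : ℕ) :
    ∀ i, gap.Adm (gap.run R K L G t i).node (gap.run R K L G t i).basis := by
  induction t with
  | zero =>
    exact fun i => ⟨good_artCols, fun i v h => by simp [GAP.run, AgentState.init, artCols] at h⟩
  | succ t ih =>
    intro i
    have hV : gap.ColsFeasible (received G t (gap.run R K L G t) i) := fun i' v hv => by
      obtain ⟨j, -, hj⟩ := Finset.mem_biUnion.1 hv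
      exact (ih j).colsFeasible _ _ hj
    have hV' : gap.ColsFeasible ((gap.run R K L G t i).basis ∪
        received G t (gap.run R K L G t) i) := fun i' v hv => by
      rcases Finset.mem_union.1 hv with h | h
      · exact (ih i).colsFeasible _ _ h
      · exact hV _ _ h
    rw [GAP.run_succ]
    cases hh : (gap.run R K L G t i).halted with
    | true => rw [GAP.step_of_halted hh]; exact ih i
    | false =>
      have hfin : gap.Adm
          (gap.finish R K (gap.run R K L G t i) (gap.run R K L G t i).basis
            (received G t (gap.run R K L G t) i)).node
          (gap.finish R K (gap.run R K L G t i) (gap.run R K L G t i).basis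
            (received G t (gap.run R K L G t) i)).basis := by
        cases hf : (gap.finish R K (gap.run R K L G t i) (gap.run R K L G t i).basis
            (received G t (gap.run R K L G t) i)).halted with
        | true =>
          obtain ⟨h1, h2⟩ := GAP.finish_of_halted hf
          rw [h1, h2]
          exact ih i
        | false =>
          rw [(GAP.finish_of_not_halted hf).1]
          exact GAP.adm_optBasis_rmpCols R K hV'
      rcases gap.step_cases R K L G t (gap.run R K L G t) i hh with
        ⟨-, -, h1, h2, -⟩ | ⟨-, -, h1⟩ | ⟨-, h1⟩
      · have h3 : (gap.step R K L G t (gap.run R K L G t) i).node =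
            (gap.run R K L G t i).node := congrArg Core.node h1
        rw [h2, h3]
        exact GAP.adm_colGen R K i hV'
      · rwa [h1]
      · rwa [h1]

theorem GAP.label_succ (gap : GAP N M) (R : Routines gap) (K : ℝ) (L : ℕ)
    (G : ℕ → Digraph (Fin N)) (t : ℕ) (i : Fin N) :
    (gap.run R K L G t i).label ≤ (gap.run R K L G (t + 1) i).label ∧
      (gap.run R K L G (t + 1) i).label ≤ (gap.run R K L G t i).label + 1 := by
  rw [GAP.run_succ]
  cases hh : (gap.run R K L G t i).halted with
  | true => rw [GAP.step_of_halted hh]; omega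
  | false =>
    rcases gap.step_cases R K L G t (gap.run R K L G t) i hh with
      ⟨-, -, h1, -⟩ | ⟨-, -, h1⟩ | ⟨-, h1⟩
    · have h3 : (gap.step R K L G t (gap.run R K L G t) i).label =
        (gap.run R K L G t i).label := congrArg Core.label h1
      omega
    · rw [h1, GAP.finish_label]; omega
    · rw [h1, GAP.finish_label]; omega

/-- The counter certifies an unchanged past. Halted agents are excluded because halting changes the
core without resetting the counter. -/
theorem GAP.count_spec (gap : GAP N M) (R : Routines gap) (K : ℝ) (L : ℕ)
    (G : ℕ → Digraph (Fin N)) (t : ℕ) (i : Fin N) (h : (gap.run R K L G t i).halted = false) :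
    (gap.run R K L G t i).count ≤ t ∧ ∀ k ≤ (gap.run R K L G t i).count,
      (gap.run R K L G (t - k) i).core = (gap.run R K L G t i).core ∧
      (gap.run R K L G (t - k) i).basis = (gap.run R K L G t i).basis := by
  induction t with
  | zero =>
    refine ⟨le_rfl, fun k _ => ?_⟩
    rw [Nat.zero_sub]
    exact ⟨rfl, rfl⟩
  | succ t ih =>
    have zero_case : (gap.run R K L G (t + 1) i).count = 0 →
        (gap.run R K L G (t + 1) i).count ≤ t + 1 ∧ ∀ k ≤ (gap.run R K L G (t + 1) i).count,
          (gap.run R K L G (t + 1 - k) i).core = (gap.run R K L G (t + 1) i).core ∧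
          (gap.run R K L G (t + 1 - k) i).basis = (gap.run R K L G (t + 1) i).basis := by
      intro h0
      rw [h0]
      refine ⟨Nat.zero_le _, fun k hk => ?_⟩
      rw [Nat.le_zero.1 hk]
      exact ⟨rfl, rfl⟩
    cases hh : (gap.run R K L G t i).halted with
    | true => rw [GAP.run_succ, GAP.step_of_halted hh, hh] at h; cases h
    | false =>
      obtain ⟨ih1, ih2⟩ := ih hh
      rcases gap.step_cases R K L G t (gap.run R K L G t) i hh with
        ⟨-, -, h1, -, h2⟩ | ⟨-, -, h1⟩ | ⟨-, h1⟩
      · rw [← GAP.run_succ] at h1 h2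
        split_ifs at h2 with h3
        · refine ⟨by omega, fun k hk => ?_⟩
          rcases k with _ | k
          · exact ⟨rfl, rfl⟩
          · obtain ⟨h4, h5⟩ := ih2 k (by omega)
            rw [Nat.add_sub_add_right]
            exact ⟨h4.trans h1.symm, h5.trans h3.symm⟩
        · exact zero_case h2
      · rw [← GAP.run_succ] at h1
        rw [h1] at h
        exact zero_case (h1 ▸ (GAP.finish_of_not_halted h).2)
      · rw [← GAP.run_succ] at h1
        rw [h1] at h
        exact zero_case (h1 ▸ (GAP.finish_of_not_halted h).2)

end

/-! ### Spreading of information -/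

/-- In each window of `L` rounds the set of informed agents gains a member unless it is already
everything, so `N - 1` windows suffice. The hypotheses are needed only during these rounds. -/
theorem spread {L : ℕ} {G : ℕ → Digraph (Fin N)} (hG : LStronglyConnected L G)
    {S : ℕ → Fin N → Prop} {t₀ : ℕ} {i₀ : Fin N} (h₀ : S t₀ i₀)
    (hmono : ∀ t, t₀ ≤ t → t < t₀ + (N - 1) * L → ∀ i, S t i → S (t + 1) i)
    (hadj : ∀ t, t₀ ≤ t → t < t₀ + (N - 1) * L → ∀ i k, (G t).Adj k i → S t k → S (t + 1) i) :
    ∀ i, S (t₀ + (N - 1) * L) i := by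
  have hle : ∀ t t', t₀ ≤ t → t ≤ t' → t' ≤ t₀ + (N - 1) * L → ∀ i, S t i → S t' i := by
    intro t t' h1 h2
    induction t', h2 using Nat.le_induction with
    | base => exact fun _ _ h => h
    | succ t' h2 ih => exact fun h3 i h => hmono t' (by omega) (by omega) i (ih (by omega) i h)
  have hcard : ∀ k ≤ N - 1, k + 1 ≤ (Finset.univ.filter (S (t₀ + k * L))).card := by
    intro k
    induction k with
    | zero =>
      intro _
      exact Finset.card_pos.2 ⟨i₀, by simpa using h₀⟩
    | succ k ih =>
      intro hk
      have ih' := ih (by omega)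
      have hkL : t₀ + (k + 1) * L ≤ t₀ + (N - 1) * L :=
        Nat.add_le_add_left (Nat.mul_le_mul_right L hk) _
      have hkL' : t₀ + k * L + L = t₀ + (k + 1) * L := by ring
      have hsub : Finset.univ.filter (S (t₀ + k * L)) ⊆
          Finset.univ.filter (S (t₀ + (k + 1) * L)) := by
        intro i hi
        simp only [Finset.mem_filter, Finset.mem_univ, true_and] at hi ⊢
        exact hle _ _ (by omega) (by omega) hkL i hi
      by_cases hall : ∀ i, S (t₀ + k * L) i
      · have : Finset.univ.filter (S (t₀ + (k + 1) * L)) = Finset.univ := by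
          ext i
          simpa using hsub (by simpa using hall i)
        rw [this, Finset.card_univ, Fintype.card_fin]
        omega
      · push Not at hall
        obtain ⟨j, hj⟩ := hall
        obtain ⟨i, hi⟩ := Finset.card_pos.1 ((Nat.succ_pos k).trans_le ih')
        simp only [Finset.mem_filter, Finset.mem_univ, true_and] at hi
        -- Strong connectivity of the union over the window gives an edge that leaves the informed
        -- set.
        have hex : ∃ a b, S (t₀ + k * L) a ∧ ¬ S (t₀ + k * L) b ∧
            ∃ τ, t₀ + k * L ≤ τ ∧ τ < t₀ + k * L + L ∧ (G τ).Adj a b := by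
          by_contra! hno
          refine hj ?_
          have hpath := hG.2 (t₀ + k * L) i j
          induction hpath with
          | refl => exact hi
          | @tail b c _ hbc ih =>
            obtain ⟨τ, h1, h2, h3⟩ := hbc
            by_contra hc
            by_cases hb : S (t₀ + k * L) b
            · exact hno _ _ hb hc τ h1 h2 h3
            · exact hb (ih hb)
        obtain ⟨a, b, ha, hb, τ, h1, h2, h3⟩ := hex
        have hb' : S (t₀ + (k + 1) * L) b :=
          hle (τ + 1) _ (by omega) (by omega) hkL b
            (hadj τ (by omega) (by omega) b a h3 (hle _ τ (by omega) h1 (by omega) a ha))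
        have : Finset.univ.filter (S (t₀ + k * L)) ⊂
            Finset.univ.filter (S (t₀ + (k + 1) * L)) :=
          (Finset.ssubset_iff_of_subset hsub).2 ⟨b, by simpa using hb', by simpa using hb⟩
        have := Finset.card_lt_card this
        omega
  intro i
  have hN : 0 < N := i.pos
  have h1 := hcard (N - 1) le_rfl
  have h2 : Finset.univ.filter (S (t₀ + (N - 1) * L)) = Finset.univ := by
    refine Finset.eq_univ_of_card _ (le_antisymm (Finset.card_le_univ _) ?_)
    rw [Fintype.card_fin]
    omega
  simpa using h2.ge (Finset.mem_univ i)

end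

section

variable {N M : ℕ} {gap : GAP N M} {R : Routines gap} {K : ℝ} {L : ℕ} {G : ℕ → Digraph (Fin N)}

/-! ### Solving one problem -/

/-- The agent still works on the problem that precedes `κ`, and holds its final basis `B`. -/
structure Old (gap : GAP N M) (R : Routines gap) (K : ℝ) (κ : Core N M) (B : Finset (Col N M))
    (Δ : Node N M) (s : AgentState N M) : Prop where
  label : s.label + 1 = κ.label
  halted : s.halted = false
  basis : s.basis = B
  node : s.node = Δ
  finish : ∀ V, (gap.finish R K s B V).core = κ

/-- At time `t` every agent works on the problem `κ` or is about to pass to it. -/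
def Mixed (gap : GAP N M) (R : Routines gap) (K : ℝ) (L : ℕ) (G : ℕ → Digraph (Fin N))
    (κ : Core N M) (B : Finset (Col N M)) (Δ : Node N M) (t : ℕ) : Prop :=
  ∀ i, Old gap R K κ B Δ (gap.run R K L G t i) ∨ (gap.run R K L G t i).core = κ

section

variable {κ : Core N M} {B : Finset (Col N M)} {Δ : Node N M} {t : ℕ}

theorem Old.core_ne {s : AgentState N M} (h : Old gap R K κ B Δ s) : s.core ≠ κ := by
  intro h'
  have : s.label = κ.label := congrArg Core.label h'
  have := h.label
  omega

theorem Mixed.label_le (h : Mixed gap R K L G κ B Δ t) (i : Fin N) :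
    (gap.run R K L G t i).label ≤ κ.label := by
  rcases h i with h | h
  · have := h.label
    omega
  · exact (congrArg Core.label h).le

/-- A round in which agent `i`, working on the problem `κ`, does not finish it. -/
theorem step_of_core_eq (hκ : κ.halted = false) {i : Fin N}
    (hi : (gap.run R K L G t i).core = κ)
    (hle : (gap.run R K L G (t + 1) i).label ≤ κ.label) :
    (gap.run R K L G (t + 1) i).core = κ ∧
    (gap.run R K L G (t + 1) i).basis = gap.colGen R K i κ.node
      ((gap.run R K L G t i).basis ∪ received G t (gap.run R K L G t) i) ∧
    (gap.run R K L G (t + 1) i).count < 2 * N * L + 1 ∧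
    (gap.run R K L G (t + 1) i).count =
      if (gap.run R K L G (t + 1) i).basis = (gap.run R K L G t i).basis then
        (gap.run R K L G t i).count + 1 else 0 := by
  have hh : (gap.run R K L G t i).halted = false := (congrArg Core.halted hi).trans hκ
  have hn : (gap.run R K L G t i).node = κ.node := congrArg Core.node hi
  have hl : (gap.run R K L G t i).label = κ.label := congrArg Core.label hi
  rw [GAP.run_succ] at hle ⊢
  rcases gap.step_cases R K L G t (gap.run R K L G t) i hh with
    ⟨-, h1, h2, h3, h4⟩ | ⟨-, -, h1⟩ | ⟨-, h1⟩
  · exact ⟨h2.trans hi, by rw [h3, hn], h1, h4⟩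
  · rw [h1, GAP.finish_label] at hle
    omega
  · rw [h1, GAP.finish_label] at hle
    omega

/-- A lagging agent either hears only lagging agents, and keeps `B` or passes to `κ` by its count,
or hears a larger label and passes to `κ`, starting from a pool that contains the basis it heard.
Either way potentials on `κ` propagate along edges. The condition on the label covers the root
problem, which no agent can lag behind. -/
theorem Mixed.step (hfix : κ.label ≠ 0 → ∀ j, gap.colGen R K j Δ B = B)
    (h : Mixed gap R K L G κ B Δ t)
    {i : Fin N} (hle : (gap.run R K L G (t + 1) i).label ≤ κ.label) :
    (Old gap R K κ B Δ (gap.run R K L G (t + 1) i) ∨ (gap.run R K L G (t + 1) i).core = κ) ∧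
    ∀ k, (k = i ∨ (G t).Adj k i) → (gap.run R K L G t k).core = κ →
      (gap.run R K L G (t + 1) i).core = κ ∧
      (κ.halted = false → gap.pot K R.rank (gap.run R K L G t k).basis ≤
        gap.pot K R.rank (gap.run R K L G (t + 1) i).basis) := by
  have hadm := gap.adm_run R K L G t
  rcases h i with hi | hi
  · have hne : ∀ k, (k = i ∨ (G t).Adj k i) → (gap.run R K L G t k).core = κ → (G t).Adj k i := by
      rintro k (rfl | hk) hc
      · exact absurd hc hi.core_ne
      · exact hk
    have hil := hi.label
    rcases gap.step_cases R K L G t (gap.run R K L G t) i hi.halted with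
      ⟨h0, -, h2, h3, -⟩ | ⟨h0, -, h1⟩ | ⟨-, h1⟩
    · rw [← GAP.run_succ] at h2 h3
      -- No larger label was received, so all in-neighbours lag as well and the pool is exactly `B`.
      have hB : (gap.run R K L G t i).basis ∪ received G t (gap.run R K L G t) i = B := by
        refine Finset.Subset.antisymm (Finset.union_subset hi.basis.subset ?_)
          (hi.basis.symm.subset.trans Finset.subset_union_left)
        refine Finset.biUnion_subset.2 fun j hj => ?_
        have hj' : (G t).Adj j i := by simpa [inNbr] using hj
        rcases h j with h4 | h4
        · exact h4.basis.subset
        · have := h0 j hj'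
          have : (gap.run R K L G t j).label = κ.label := congrArg Core.label h4
          omega
      rw [hB, hi.node, hfix (by omega)] at h3
      refine ⟨Or.inl ⟨?_, ?_, h3, ?_, fun V => ?_⟩, fun k hk hc => ?_⟩
      · rw [← hil]
        exact congrArg (Core.label · + 1) h2
      · exact (congrArg Core.halted h2).trans hi.halted
      · exact (congrArg Core.node h2).trans hi.node
      · rw [GAP.core_finish_congr h2 B V V]
        exact hi.finish V
      · have := h0 k (hne k hk hc)
        have : (gap.run R K L G t k).label = κ.label := congrArg Core.label hc
        omega
    · rw [← GAP.run_succ, hi.basis] at h1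
      refine ⟨Or.inr (h1 ▸ hi.finish _), fun k hk hc => ?_⟩
      have := h0 k (hne k hk hc)
      have : (gap.run R K L G t k).label = κ.label := congrArg Core.label hc
      omega
    · rw [← GAP.run_succ, hi.basis] at h1
      have hc' : (gap.run R K L G (t + 1) i).core = κ := h1 ▸ hi.finish _
      refine ⟨Or.inr hc', fun k hk hc => ⟨hc', fun hκ => ?_⟩⟩
      have hh : (gap.run R K L G (t + 1) i).halted = false :=
        (congrArg Core.halted hc').trans hκ
      have hn : (gap.run R K L G (t + 1) i).node = (gap.run R K L G t k).node :=
        (congrArg Core.node hc').trans (congrArg Core.node hc).symm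
      rw [h1] at hh
      have hb := (GAP.finish_of_not_halted hh).1
      rw [← h1, hn] at hb
      rw [hb]
      exact (hadm k).pot_le_optBasis_rmpCols R K
        ((basis_subset_received (hne k hk hc)).trans Finset.subset_union_right)
  · cases hκ : κ.halted with
    | true =>
      have hs : gap.run R K L G (t + 1) i = gap.run R K L G t i :=
        GAP.step_of_halted ((congrArg Core.halted hi).trans hκ)
      rw [hs]
      exact ⟨Or.inr hi, fun k _ _ => ⟨hi, fun h => by cases h⟩⟩
    | false =>
      obtain ⟨h1, h2, -, -⟩ := step_of_core_eq hκ hi hle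
      refine ⟨Or.inr h1, fun k hk hc => ⟨h1, fun _ => ?_⟩⟩
      have hn : (gap.run R K L G t k).node = κ.node := congrArg Core.node hc
      rw [h2]
      refine (hn ▸ hadm k).pot_le_colGen R K i ?_
      rcases hk with rfl | hk
      · exact Finset.subset_union_left
      · exact (basis_subset_received hk).trans Finset.subset_union_right

theorem Mixed.of_le (hfix : κ.label ≠ 0 → ∀ j, gap.colGen R K j Δ B = B) {T t₁ : ℕ}
    (h : Mixed gap R K L G κ B Δ T)
    (hle : ∀ t ≤ t₁, ∀ i, (gap.run R K L G t i).label ≤ κ.label) {t : ℕ} (h1 : T ≤ t)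
    (h2 : t ≤ t₁) : Mixed gap R K L G κ B Δ t := by
  induction t, h1 using Nat.le_induction with
  | base => exact h
  | succ t _ ih => exact fun i => (Mixed.step hfix (ih (by omega)) (hle _ h2 i)).1

/-- The problem `κ` has just been reached by some agent. -/
structure Starts (gap : GAP N M) (R : Routines gap) (K : ℝ) (L : ℕ) (G : ℕ → Digraph (Fin N))
    (κ : Core N M) (B : Finset (Col N M)) (Δ : Node N M) (T : ℕ) : Prop where
  fixed : κ.label ≠ 0 → ∀ j, gap.colGen R K j Δ B = B
  mixed : Mixed gap R K L G κ B Δ T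
  reached : ∃ i, (gap.run R K L G T i).core = κ
  earlier : ∀ t < T, ∀ i, (gap.run R K L G t i).label < κ.label

theorem Starts.mixed_of_le {T t₁ : ℕ} (h : Starts gap R K L G κ B Δ T)
    (hle : ∀ t ≤ t₁, ∀ i, (gap.run R K L G t i).label ≤ κ.label) {t : ℕ} (h1 : T ≤ t)
    (h2 : t ≤ t₁) : Mixed gap R K L G κ B Δ t :=
  h.mixed.of_le h.fixed hle h1 h2

/-- Halted agents keep sending their label, which pulls every lagging agent into the same halted
core. -/
theorem Starts.eventually_of_halted {T : ℕ} (hG : LStronglyConnected L G)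
    (h : Starts gap R K L G κ B Δ T) (hκ : κ.halted = true) :
    ∃ T', ∀ t, T' ≤ t → ∀ i, (gap.run R K L G t i).core = κ := by
  have hmix : ∀ t, T ≤ t → Mixed gap R K L G κ B Δ t ∧
      ∀ i, (gap.run R K L G (t + 1) i).label ≤ κ.label := by
    have key : ∀ t, Mixed gap R K L G κ B Δ t →
        ∀ i, (gap.run R K L G (t + 1) i).label ≤ κ.label := by
      intro t ht i
      rcases ht i with h1 | h1
      · have := h1.label
        have := (gap.label_succ R K L G t i).2
        omega
      · have hs : gap.run R K L G (t + 1) i = gap.run R K L G t i :=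
          GAP.step_of_halted ((congrArg Core.halted h1).trans hκ)
        rw [hs]
        exact ht.label_le i
    intro t ht
    induction t, ht using Nat.le_induction with
    | base => exact ⟨h.mixed, key T h.mixed⟩
    | succ t _ ih =>
      have : Mixed gap R K L G κ B Δ (t + 1) := fun i =>
        (Mixed.step h.fixed ih.1 (ih.2 i)).1
      exact ⟨this, key _ this⟩
  obtain ⟨i₀, hi₀⟩ := h.reached
  have hall : ∀ i, (gap.run R K L G (T + (N - 1) * L) i).core = κ := by
    refine spread (S := fun t i => (gap.run R K L G t i).core = κ) hG hi₀ ?_ ?_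
    · intro t ht _ i hi
      exact ((Mixed.step h.fixed (hmix t ht).1 ((hmix t ht).2 i)).2 i (Or.inl rfl) hi).1
    · intro t ht _ i k hk hc
      exact ((Mixed.step h.fixed (hmix t ht).1 ((hmix t ht).2 i)).2 k (Or.inr hk) hc).1
  refine ⟨T + (N - 1) * L, fun t ht => ?_⟩
  induction t, ht using Nat.le_induction with
  | base => exact hall
  | succ t ht ih =>
    intro i
    have hm := hmix t (by omega)
    exact ((Mixed.step h.fixed hm.1 (hm.2 i)).2 i (Or.inl rfl) (ih i)).1

theorem exists_forall_eq_of_monotone_of_bounded {f : ℕ → ℕ} {T C : ℕ}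
    (hf : ∀ t, T ≤ t → f t ≤ f (t + 1)) (hC : ∀ t, f t ≤ C) :
    ∃ T', T ≤ T' ∧ ∀ t, T' ≤ t → f t = f T' := by
  have hmono : ∀ t t', T ≤ t → t ≤ t' → f t ≤ f t' := by
    intro t t' h1 h2
    induction t', h2 using Nat.le_induction with
    | base => exact le_rfl
    | succ t' h2 ih => exact ih.trans (hf t' (by omega))
  by_contra! hno
  have hunb : ∀ k, ∃ t, T ≤ t ∧ k ≤ f t := by
    intro k
    induction k with
    | zero => exact ⟨T, le_rfl, Nat.zero_le _⟩
    | succ k ih =>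
      obtain ⟨t, h1, h2⟩ := ih
      obtain ⟨t', h3, h4⟩ := hno t h1
      have := hmono t t' h1 h3
      exact ⟨t', by omega, by omega⟩
  obtain ⟨t, -, ht⟩ := hunb (C + 1)
  have := hC t
  omega

/-- Some agent finishes the problem `κ`. -/
theorem Starts.exists_label_gt {T : ℕ} (h : Starts gap R K L G κ B Δ T)
    (hκ : κ.halted = false) : ∃ t, ∃ i, κ.label < (gap.run R K L G t i).label := by
  by_contra! hle
  have hmix : ∀ t, T ≤ t → Mixed gap R K L G κ B Δ t := fun t ht =>
    h.mixed_of_le (t₁ := t) (fun t _ i => hle t i) ht le_rfl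
  obtain ⟨i, hi⟩ := h.reached
  have hcore : ∀ t, T ≤ t → (gap.run R K L G t i).core = κ := by
    intro t ht
    induction t, ht using Nat.le_induction with
    | base => exact hi
    | succ t ht ih => exact (step_of_core_eq hκ ih (hle _ _)).1
  -- The potential of one agent is monotone and at most the number of column sets, so it is
  -- eventually constant; then the basis is too, and the counter must overrun its bound.
  obtain ⟨T', hT', hconst⟩ := exists_forall_eq_of_monotone_of_bounded
    (f := fun t => gap.pot K R.rank (gap.run R K L G t i).basis) (T := T)
    (C := Fintype.card (Finset (Col N M)))
    (fun t ht => ((Mixed.step h.fixed (hmix t ht) (hle _ i)).2 i (Or.inl rfl) (hcore t ht)).2 hκ)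
    (fun t => Finset.card_le_univ _)
  have hbasis : ∀ t, T' ≤ t →
      (gap.run R K L G (t + 1) i).basis = (gap.run R K L G t i).basis := fun t ht =>
    GAP.eq_of_pot_eq R.rank_injective (gap.adm_run R K L G _ i).1 (gap.adm_run R K L G _ i).1
      ((hconst (t + 1) (by omega)).trans (hconst t ht).symm)
  have hcount : ∀ k, k ≤ (gap.run R K L G (T' + k) i).count := by
    intro k
    induction k with
    | zero => exact Nat.zero_le _
    | succ k ih =>
      have h1 := (step_of_core_eq hκ (hcore (T' + k) (by omega)) (hle _ i)).2.2.2
      rw [if_pos (hbasis _ (by omega))] at h1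
      rw [← Nat.add_assoc, h1]
      omega
  have h1 := (step_of_core_eq hκ (hcore (T' + 2 * N * L) (by omega)) (hle _ i)).2.2.1
  have h2 := hcount (2 * N * L + 1)
  rw [← Nat.add_assoc] at h2
  omega

/-- When the first agent finishes the problem `κ`, all agents hold the same final basis. -/
theorem Starts.consensus {T t₁ : ℕ} (hG : LStronglyConnected L G)
    (h : Starts gap R K L G κ B Δ T) (hκ : κ.halted = false)
    (hle : ∀ t ≤ t₁, ∀ i, (gap.run R K L G t i).label ≤ κ.label) (hT : T ≤ t₁) {i₀ : Fin N}
    (hi₀ : κ.label < (gap.run R K L G (t₁ + 1) i₀).label) :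
    ∃ B', (∀ i, gap.colGen R K i κ.node B' = B') ∧
      ∀ i, (gap.run R K L G t₁ i).core = κ ∧ (gap.run R K L G t₁ i).basis = B' := by
  have hmix : ∀ t, T ≤ t → t ≤ t₁ → Mixed gap R K L G κ B Δ t := fun t h1 h2 =>
    h.mixed_of_le hle h1 h2
  have hgood : ∀ t i, Good (gap.run R K L G t i).basis := fun t i =>
    (gap.adm_run R K L G t i).1
  -- the first agent to finish has held its basis for `2 * N * L` rounds
  obtain ⟨hh, hcnt⟩ : (gap.run R K L G t₁ i₀).halted = false ∧
      2 * N * L ≤ (gap.run R K L G t₁ i₀).count := by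
    have hl := (gap.label_succ R K L G t₁ i₀).2
    have hl' := hle t₁ le_rfl i₀
    rw [GAP.run_succ] at hi₀
    cases hh : (gap.run R K L G t₁ i₀).halted with
    | true =>
      rw [GAP.step_of_halted hh] at hi₀
      omega
    | false =>
      rcases gap.step_cases R K L G t₁ (gap.run R K L G t₁) i₀ hh with
        ⟨-, -, h2, -⟩ | ⟨-, h2, -⟩ | ⟨⟨j, -, hj⟩, -⟩
      · rw [show (gap.step R K L G t₁ (gap.run R K L G t₁) i₀).label =
          (gap.run R K L G t₁ i₀).label from congrArg Core.label h2] at hi₀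
        omega
      · exact ⟨rfl, h2⟩
      · have := hle t₁ le_rfl j
        rw [GAP.run_succ] at hl
        omega
  have hlab : (gap.run R K L G t₁ i₀).label = κ.label := by
    have := (gap.label_succ R K L G t₁ i₀).2
    have := hle t₁ le_rfl i₀
    omega
  have hcore₁ : (gap.run R K L G t₁ i₀).core = κ := by
    rcases hmix t₁ hT le_rfl i₀ with h1 | h1
    · have := h1.label
      omega
    · exact h1
  obtain ⟨hct, hcs⟩ := gap.count_spec R K L G t₁ i₀ hh
  set b := (gap.run R K L G t₁ i₀).basis with hb
  obtain ⟨t₀, ht₀⟩ : ∃ t₀, t₁ = t₀ + 2 * N * L := ⟨t₁ - 2 * N * L, by omega⟩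
  have hi₀s : ∀ t, t₀ ≤ t → t ≤ t₁ →
      (gap.run R K L G t i₀).core = κ ∧ (gap.run R K L G t i₀).basis = b := by
    intro t h1 h2
    have := hcs (t₁ - t) (by omega)
    rw [Nat.sub_sub_self h2, hcore₁] at this
    exact this
  have hTt₀ : T ≤ t₀ := by
    by_contra hlt
    have h1 := h.earlier t₀ (not_le.1 hlt) i₀
    have h2 : (gap.run R K L G t₀ i₀).label = κ.label :=
      congrArg Core.label (hi₀s t₀ le_rfl (by omega)).1
    omega
  -- Two spreading times make a round trip; the surplus `2 * L` leaves room for at least one full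
  -- round in which all agents are known to agree.
  have hNL : 2 * N * L = (N - 1) * L + (N - 1) * L + 2 * L := by
    obtain ⟨n, hn⟩ : ∃ n, N = n + 1 := ⟨N - 1, by have := i₀.pos; omega⟩
    subst hn
    rw [Nat.add_sub_cancel]
    ring
  have hL := hG.1
  set D := (N - 1) * L with hD
  have hspread : ∀ t, T ≤ t → t + D ≤ t₁ → ∀ k, (gap.run R K L G t k).core = κ → ∀ j,
      (gap.run R K L G (t + D) j).core = κ ∧ gap.pot K R.rank (gap.run R K L G t k).basis ≤
        gap.pot K R.rank (gap.run R K L G (t + D) j).basis := by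
    intro t h1 h2 k hk
    refine spread (S := fun t' i => (gap.run R K L G t' i).core = κ ∧
      gap.pot K R.rank (gap.run R K L G t k).basis ≤
        gap.pot K R.rank (gap.run R K L G t' i).basis) hG ⟨hk, le_rfl⟩ ?_ ?_
    · intro t' h3 h4 i ⟨h5, h6⟩
      have := (Mixed.step h.fixed (hmix t' (by omega) (by omega)) (hle _ (by omega) i)).2 i
        (Or.inl rfl) h5
      exact ⟨this.1, h6.trans (this.2 hκ)⟩
    · intro t' h3 h4 i k' h7 ⟨h5, h6⟩
      have := (Mixed.step h.fixed (hmix t' (by omega) (by omega)) (hle _ (by omega) i)).2 k'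
        (Or.inr h7) h5
      exact ⟨this.1, h6.trans (this.2 hκ)⟩
  -- Information goes from `i₀` to `j` and back while the basis of `i₀` stays `b`, so the potential
  -- of `j` is squeezed between two copies of that of `b`.
  have hsync : ∀ t, t₀ + D ≤ t → t + D ≤ t₁ → ∀ j,
      (gap.run R K L G t j).core = κ ∧ (gap.run R K L G t j).basis = b := by
    intro t h1 h2 j
    obtain ⟨t', rfl⟩ : ∃ t', t = t' + D := ⟨t - D, by omega⟩
    have h3 := hi₀s t' (by omega) (by omega)
    have h4 := hspread t' (by omega) (by omega) i₀ h3.1 j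
    have h5 := hspread (t' + D) (by omega) h2 j h4.1 i₀
    rw [h3.2] at h4
    rw [(hi₀s (t' + D + D) (by omega) h2).2] at h5
    exact ⟨h4.1, GAP.eq_of_pot_eq R.rank_injective (hgood _ _) (hgood _ _)
      (le_antisymm h5.2 h4.2)⟩
  have hround : ∀ t, T ≤ t → t + 1 ≤ t₁ →
      (∀ j, (gap.run R K L G t j).core = κ ∧ (gap.run R K L G t j).basis = b) →
      ∀ j, (gap.run R K L G (t + 1) j).core = κ ∧
        (gap.run R K L G (t + 1) j).basis = gap.colGen R K j κ.node b := by
    intro t h1 h2 h3 j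
    obtain ⟨h4, h5, -⟩ := step_of_core_eq hκ (h3 j).1 (hle _ h2 j)
    have h6 : (gap.run R K L G t j).basis ∪ received G t (gap.run R K L G t) j = b := by
      rw [(h3 j).2]
      refine Finset.union_eq_left.2 (Finset.biUnion_subset.2 fun k _ => ?_)
      rw [(h3 k).2]
    rw [h6] at h5
    exact ⟨h4, h5⟩
  -- Compare two consecutive rounds of the window: everyone holds `b` before and after, so one round
  -- of column generation from `b` returns `b`.
  have hfix : ∀ j, gap.colGen R K j κ.node b = b := fun j => by
    rw [← (hround (t₀ + D) (by omega) (by omega) (hsync _ le_rfl (by omega)) j).2]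
    exact (hsync (t₀ + D + 1) (by omega) (by omega) j).2
  refine ⟨b, hfix, ?_⟩
  have hend : ∀ t, t₀ + D ≤ t → t ≤ t₁ → ∀ j,
      (gap.run R K L G t j).core = κ ∧ (gap.run R K L G t j).basis = b := by
    intro t h1
    induction t, h1 using Nat.le_induction with
    | base => exact fun _ => hsync _ le_rfl (by omega)
    | succ t h1 ih =>
      intro h2 j
      have := hround t (by omega) h2 (ih (by omega)) j
      rwa [hfix] at this
  exact hend t₁ (by omega) le_rfl

/-- The passage from one problem to the next one. -/
theorem Starts.next {T : ℕ} (hG : LStronglyConnected L G)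
    (h : Starts gap R K L G κ B Δ T) (hκ : κ.halted = false) :
    ∃ (T' : ℕ) (s : AgentState N M) (B' : Finset (Col N M)), s.core = κ ∧ gap.Adm κ.node B' ∧
      (∀ i, gap.colGen R K i κ.node B' = B') ∧
      Starts gap R K L G (gap.finish R K s B' ∅).core B' κ.node T' := by
  have hex := h.exists_label_gt hκ
  have hmin : ∀ t < Nat.find hex, ∀ i, (gap.run R K L G t i).label ≤ κ.label := by
    intro t ht i
    by_contra hc
    exact Nat.find_min hex ht ⟨i, not_le.1 hc⟩
  obtain ⟨i₀, hi₀⟩ := Nat.find_spec hex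
  have hTt : T < Nat.find hex := by
    by_contra hc
    rcases (not_lt.1 hc).lt_or_eq with h1 | h1
    · have := h.earlier _ h1 i₀
      omega
    · have := h.mixed.label_le i₀
      rw [h1] at hi₀
      omega
  obtain ⟨t₁, ht₁⟩ : ∃ t₁, Nat.find hex = t₁ + 1 := ⟨Nat.find hex - 1, by omega⟩
  rw [ht₁] at hmin hi₀ hTt
  have hle : ∀ t ≤ t₁, ∀ i, (gap.run R K L G t i).label ≤ κ.label := fun t ht =>
    hmin t (by omega)
  obtain ⟨B', hfix, hsync⟩ := h.consensus hG hκ hle (by omega) hi₀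
  have hadm : gap.Adm κ.node B' := by
    have h1 := gap.adm_run R K L G t₁ i₀
    have h2 : (gap.run R K L G t₁ i₀).node = κ.node := congrArg Core.node (hsync i₀).1
    rwa [h2, (hsync i₀).2] at h1
  refine ⟨t₁ + 1, gap.run R K L G t₁ i₀, B', (hsync i₀).1, hadm, hfix, ?_⟩
  set κ' := (gap.finish R K (gap.run R K L G t₁ i₀) B' ∅).core with hκ'
  have hlabel : κ'.label = κ.label + 1 := by
    have h1 : κ'.label = (gap.run R K L G t₁ i₀).label + 1 := GAP.finish_label _ _ _
    have h2 : (gap.run R K L G t₁ i₀).label = κ.label := congrArg Core.label (hsync i₀).1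
    omega
  have hlab : ∀ i, (gap.run R K L G t₁ i).label = κ.label := fun i =>
    congrArg Core.label (hsync i).1
  -- Just before the first transition all agents count as lagging behind the next problem, with the
  -- consensus basis as their final basis.
  have hold : Mixed gap R K L G κ' B' κ.node t₁ := fun i => Or.inl
    { label := by rw [hlab, hlabel]
      halted := (congrArg Core.halted (hsync i).1).trans hκ
      basis := (hsync i).2
      node := congrArg Core.node (hsync i).1
      finish := fun V => GAP.core_finish_congr ((hsync i).1.trans (hsync i₀).1.symm) _ _ _ }
  have hmixed : Mixed gap R K L G κ' B' κ.node (t₁ + 1) := fun i =>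
    (Mixed.step (fun _ => hfix) hold (by
      have := (gap.label_succ R K L G t₁ i).2
      have := hlab i
      omega)).1
  refine ⟨fun _ => hfix, hmixed, ⟨i₀, ?_⟩, fun t ht i => ?_⟩
  · rcases hmixed i₀ with h1 | h1
    · have := h1.label
      omega
    · exact h1
  · have := hle t (by omega) i
    omega

end

end

section

variable {N M : ℕ} {gap : GAP N M} {R : Routines gap} {K : ℝ} {L : ℕ} {G : ℕ → Digraph (Fin N)}

/-! ### Correctness of the tree search -/

/-- The incumbent is feasible, and every feasible point that is better than the incumbent belongs
to an open problem. -/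
structure Core.Valid (gap : GAP N M) (κ : Core N M) : Prop where
  incumbent : κ.Jinc = ⊥ ∨ (gap.IsFeasible κ.zinc ∧ κ.Jinc = (gap.value κ.zinc : EReal))
  covered : ∀ z, gap.IsFeasible z → (gap.value z : EReal) ≤ κ.Jinc ∨
    (κ.halted = false ∧ ∃ Δ ∈ insert κ.node κ.tree, NodeSat Δ z)

/-- A bound for the size of the subtree below a problem. -/
def nodeWeight (Δ : Node N M) : ℕ := 3 ^ Δᶜ.card

theorem nodeWeight_pos (Δ : Node N M) : 0 < nodeWeight Δ := by
  unfold nodeWeight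
  positivity

theorem nodeWeight_insert {Δ : Node N M} {e : Fin N × Fin M × Bool} (he : e ∉ Δ) :
    3 * nodeWeight (insert e Δ) = nodeWeight Δ := by
  have h1 : (insert e Δ)ᶜ = Δᶜ.erase e := by
    ext x
    simp
  have h2 : (Δᶜ.erase e).card + 1 = Δᶜ.card :=
    Finset.card_erase_add_one (Finset.mem_compl.2 he)
  rw [nodeWeight, nodeWeight, h1, ← h2, pow_succ, mul_comm]

/-- A bound for the number of problems that remain to be solved. -/
def Core.weight (κ : Core N M) : ℕ := nodeWeight κ.node + ∑ Δ ∈ κ.tree, nodeWeight Δ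

theorem NodeSat.insert {Δ : Node N M} {z : Fin N → Fin M → ℝ} (h : NodeSat Δ z) {i : Fin N}
    {m : Fin M} {b : Bool} (hb : z i m = if b then 1 else 0) :
    NodeSat (insert (i, m, b) Δ) z := by
  intro i' m' b' h'
  rcases Finset.mem_insert.1 h' with h' | h'
  · simp only [Prod.mk.injEq] at h'
    obtain ⟨rfl, rfl, rfl⟩ := h'
    exact hb
  · exact h i' m' b' h'

/-- The recovered point satisfies the constraints already imposed, so an entry fixed by them is
binary; a branching variable is therefore new in both senses of the branch. -/
theorem GAP.finishTree_cases (gap : GAP N M) (R : Routines gap) (K : ℝ) {s : AgentState N M}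
    {B : Finset (Col N M)} (hB : gap.Adm s.node B) :
    (gap.Live K s B ∧ ¬ IsBinary (recoverZ (basicSol B)) ∧ ∃ i m,
      (∀ b, (i, m, b) ∉ s.node) ∧ gap.finishTree R K s B =
        s.tree ∪ {insert (i, m, false) s.node, insert (i, m, true) s.node}) ∨
    (¬ (gap.Live K s B ∧ ¬ IsBinary (recoverZ (basicSol B))) ∧
      gap.finishTree R K s B = s.tree) := by
  by_cases h : gap.Live K s B ∧ ¬ IsBinary (recoverZ (basicSol B))
  · refine Or.inl ⟨h.1, h.2, _, _, fun b hb => ?_, by rw [GAP.finishTree, dif_pos h]⟩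
    have h1 := R.branchVar_spec s.label ⟨recoverZ (basicSol B), h.2⟩
    have h2 := hB.nodeSat_recoverZ h.1.1 _ _ _ hb
    cases b
    · exact h1.1 h2
    · exact h1.2 h2
  · exact Or.inr ⟨h, by rw [GAP.finishTree, dif_neg h]⟩

/-- Two children, each of a third of the parent's weight, weigh less than the parent; without
branching the solved problem just disappears. -/
theorem GAP.sum_finishTree_lt (gap : GAP N M) (R : Routines gap) (K : ℝ) {s : AgentState N M}
    {B : Finset (Col N M)} (hB : gap.Adm s.node B) :
    ∑ Δ ∈ gap.finishTree R K s B, nodeWeight Δ < s.core.weight := by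
  have hpos := nodeWeight_pos s.node
  have hw : s.core.weight = nodeWeight s.node + ∑ Δ ∈ s.tree, nodeWeight Δ := rfl
  rw [hw]
  rcases gap.finishTree_cases R K hB with ⟨-, -, i, m, hnew, h⟩ | ⟨-, h⟩
  · rw [h]
    have h1 : ∀ S T : Finset (Node N M), ∑ Δ ∈ S ∪ T, nodeWeight Δ ≤
        ∑ Δ ∈ S, nodeWeight Δ + ∑ Δ ∈ T, nodeWeight Δ := fun S T => by
      rw [← Finset.sum_union_inter]
      exact Nat.le_add_right _ _
    have h2 := h1 s.tree {insert (i, m, false) s.node, insert (i, m, true) s.node}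
    have h3 := h1 {insert (i, m, false) s.node} {insert (i, m, true) s.node}
    rw [Finset.sum_singleton, Finset.sum_singleton, ← Finset.insert_eq] at h3
    have h4 := nodeWeight_insert (hnew false)
    have h5 := nodeWeight_insert (hnew true)
    omega
  · rw [h]
    omega

/-- The incumbents and the open problems after the problem of the state `s` has been solved. -/
theorem Core.Valid.finish {s : AgentState N M} {B : Finset (Col N M)}
    (hK : ∀ B : Finset (Col N M), Good B → (¬ ∀ r, basicSol B (Sum.inr r) = 0) →
      ∀ z, gap.IsFeasible z → gap.lpValue K (basicSol B) < gap.value z)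
    (h : s.core.Valid gap) (hB : gap.Adm s.node B)
    (hfix : ∀ i, gap.colGen R K i s.node B = B) :
    (gap.finish R K s B ∅).core.Valid gap ∧
      ((gap.finish R K s B ∅).halted = false →
        (gap.finish R K s B ∅).core.weight < s.core.weight) := by
  set J' : EReal := if gap.Live K s B ∧ IsBinary (recoverZ (basicSol B)) then
    (gap.lpValue K (basicSol B) : EReal) else s.Jinc with hJ'
  set z' := if gap.Live K s B ∧ IsBinary (recoverZ (basicSol B)) then
    recoverZ (basicSol B) else s.zinc with hz'
  have hinc : J' = ⊥ ∨ (gap.IsFeasible z' ∧ J' = (gap.value z' : EReal)) := by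
    by_cases hl : gap.Live K s B ∧ IsBinary (recoverZ (basicSol B))
    · rw [hJ', hz', if_pos hl, if_pos hl]
      exact Or.inr ⟨hB.isFeasible_recoverZ hl.1.1 hl.2, by rw [GAP.lpValue_eq_value hl.1.1]⟩
    · rw [hJ', hz', if_neg hl, if_neg hl]
      exact h.incumbent
  have hJle : s.Jinc ≤ J' := by
    rw [hJ']
    split_ifs with hl
    · exact hl.1.2
    · exact le_rfl
  have hcov : ∀ z, gap.IsFeasible z → (gap.value z : EReal) ≤ J' ∨
      ∃ Δ ∈ gap.finishTree R K s B, NodeSat Δ z := by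
    intro z hz
    have htree : s.tree ⊆ gap.finishTree R K s B := by
      rcases gap.finishTree_cases R K hB with ⟨-, -, i, m, -, h1⟩ | ⟨-, h1⟩ <;> rw [h1]
      exact Finset.subset_union_left
    rcases h.covered z hz with h1 | ⟨-, Δ, hΔ, hsat⟩
    · exact Or.inl (h1.trans hJle)
    · rcases Finset.mem_insert.1 hΔ with rfl | hΔ
      · have hval : gap.value z ≤ gap.lpValue K (basicSol B) :=
          gap.value_le_lpValue hB hfix hz hsat
        -- A feasible point of the problem bounds the master value from below, which the big-M
        -- constant forbids when an artificial variable is nonzero. So pruning by artificial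
        -- variables loses nothing.
        have hart : ∀ r, basicSol B (Sum.inr r) = 0 := by
          by_contra hart
          exact absurd (hK B hB.1 hart z hz) (not_lt.2 hval)
        rcases gap.finishTree_cases R K hB with ⟨-, -, i, m, -, h1⟩ | ⟨hl, -⟩
        · right
          rw [h1]
          rcases (hz.1 i).1 m with h0 | h0
          · exact ⟨insert (i, m, false) s.node, by simp, hsat.insert (by simp [h0])⟩
          · exact ⟨insert (i, m, true) s.node, by simp, hsat.insert (by simp [h0])⟩
        · left
          by_cases hJ : s.Jinc ≤ (gap.lpValue K (basicSol B) : EReal)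
          · have hlive : gap.Live K s B := ⟨hart, hJ⟩
            rw [hJ', if_pos ⟨hlive, by_contra fun hb => hl ⟨hlive, hb⟩⟩]
            exact EReal.coe_le_coe_iff.2 hval
          · exact ((EReal.coe_le_coe_iff.2 hval).trans (not_le.1 hJ).le).trans hJle
      · exact Or.inr ⟨Δ, htree hΔ, hsat⟩
  have hlt := gap.sum_finishTree_lt R K hB
  rw [GAP.finish_eq, ← hJ', ← hz']
  split_ifs with ht
  · refine ⟨⟨hinc, fun z hz => Or.inl ?_⟩, fun hh => by cases hh⟩
    rcases hcov z hz with h1 | ⟨Δ, hΔ, -⟩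
    · exact h1
    · rw [ht] at hΔ
      simp at hΔ
  · have hmem := R.extract_spec s.label _ (Finset.nonempty_iff_ne_empty.2 ht)
    refine ⟨⟨hinc, fun z hz => ?_⟩, fun _ => ?_⟩
    · rcases hcov z hz with h1 | ⟨Δ, hΔ, hsat⟩
      · exact Or.inl h1
      · refine Or.inr ⟨rfl, Δ, ?_, hsat⟩
        exact (Finset.insert_erase hmem).symm.subset hΔ
    · refine lt_of_eq_of_lt ?_ hlt
      exact Finset.add_sum_erase _ nodeWeight hmem

section

variable {κ : Core N M} {B : Finset (Col N M)} {Δ : Node N M} {T : ℕ}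

theorem Starts.agreement_of_halted (hG : LStronglyConnected L G)
    (hfeas : ∃ z, gap.IsFeasible z) (h : Starts gap R K L G κ B Δ T) (hκ : κ.Valid gap)
    (hh : κ.halted = true) :
    ∃ (T : ℕ) (z : Fin N → Fin M → ℝ) (J : ℝ), gap.IsOptimal z ∧ gap.value z = J ∧
      ∀ t : ℕ, T ≤ t → ∀ i : Fin N,
        (gap.run R K L G t i).Jinc = (J : EReal) ∧ (gap.run R K L G t i).zinc = z := by
  obtain ⟨T', hT'⟩ := h.eventually_of_halted hG hh
  have hcov : ∀ z, gap.IsFeasible z → (gap.value z : EReal) ≤ κ.Jinc := fun z hz =>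
    (hκ.covered z hz).resolve_right fun h' => by rw [hh] at h'; cases h'.1
  rcases hκ.incumbent with h1 | ⟨h1, h2⟩
  · obtain ⟨z, hz⟩ := hfeas
    have := hcov z hz
    rw [h1, le_bot_iff] at this
    exact absurd this (EReal.coe_ne_bot _)
  · refine ⟨T', κ.zinc, gap.value κ.zinc, ⟨h1, fun z hz => ?_⟩, rfl, fun t ht i => ?_⟩
    · have := hcov z hz
      rw [h2] at this
      exact EReal.coe_le_coe_iff.1 this
    · exact ⟨(congrArg Core.Jinc (hT' t ht i)).trans h2, congrArg Core.zinc (hT' t ht i)⟩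

/-- Induction on the weight of open work. A transition that halts is treated apart, since it keeps
the solved problem as its node and the weight need not drop. -/
theorem Starts.agreement (hG : LStronglyConnected L G)
    (hK : ∀ B : Finset (Col N M), Good B → (¬ ∀ r, basicSol B (Sum.inr r) = 0) →
      ∀ z, gap.IsFeasible z → gap.lpValue K (basicSol B) < gap.value z)
    (hfeas : ∃ z, gap.IsFeasible z)
    (h : Starts gap R K L G κ B Δ T) (hκ : κ.Valid gap) :
    ∃ (T : ℕ) (z : Fin N → Fin M → ℝ) (J : ℝ), gap.IsOptimal z ∧ gap.value z = J ∧
      ∀ t : ℕ, T ≤ t → ∀ i : Fin N,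
        (gap.run R K L G t i).Jinc = (J : EReal) ∧ (gap.run R K L G t i).zinc = z := by
  induction hn : κ.weight using Nat.strong_induction_on generalizing κ B Δ T with
  | _ n ih =>
    cases hh : κ.halted with
    | true => exact h.agreement_of_halted hG hfeas hκ hh
    | false =>
      obtain ⟨T', s, B', rfl, hadm, hfix, hs⟩ := h.next hG hh
      obtain ⟨h1, h2⟩ := hκ.finish hK hadm hfix
      cases hh' : (gap.finish R K s B' ∅).halted with
      | false => exact ih _ (hn ▸ h2 hh') hs h1 rfl
      | true => exact hs.agreement_of_halted hG hfeas h1 hh'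

end

theorem GAP.exists_isOptimal (gap : GAP N M) (hfeas : ∃ z, gap.IsFeasible z) :
    ∃ z, gap.IsOptimal z := by
  have hfin : {z | gap.IsFeasible z}.Finite := by
    refine (Set.finite_range fun (u : Fin N → Fin M → Bool) i => bvec (u i)).subset ?_
    intro z hz
    refine ⟨fun i m => decide (z i m = 1), ?_⟩
    ext i m
    rcases (hz.1 i).1 m with h | h <;> simp [bvec, h]
  obtain ⟨z, hz, hmax⟩ := hfin.exists_maximalFor gap.value _ hfeas
  exact ⟨z, hz, fun z' hz' => (le_total (gap.value z') (gap.value z)).elim id (hmax hz')⟩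

theorem starts_zero (hN : 0 < N) (gap : GAP N M) (R : Routines gap) (K : ℝ) (L : ℕ)
    (G : ℕ → Digraph (Fin N)) : Starts gap R K L G (AgentState.init N M).core ∅ ∅ 0 where
  fixed h := absurd rfl h
  mixed _ := Or.inr rfl
  reached := ⟨⟨0, hN⟩, rfl⟩
  earlier _ h := absurd h (Nat.not_lt_zero _)

end

end BnP

end

theorem theorem1 {N M : ℕ} (gap : BnP.GAP N M) (hfeas : ∃ z, gap.IsFeasible z) :
    ∃ K₀ : ℝ, ∀ K : ℝ, K₀ ≤ K →
      ∀ (L : ℕ) (G : ℕ → Digraph (Fin N)), BnP.LStronglyConnected L G →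
      ∀ R : BnP.Routines gap,
      ∃ (T : ℕ) (z : Fin N → Fin M → ℝ) (J : ℝ), gap.IsOptimal z ∧ gap.value z = J ∧
        ∀ t : ℕ, T ≤ t → ∀ i : Fin N,
          (gap.run R K L G t i).Jinc = (J : EReal) ∧ (gap.run R K L G t i).zinc = z := by
  obtain ⟨K₀, hK₀⟩ := Filter.eventually_atTop.1 gap.eventually_bigM
  refine ⟨K₀, fun K hK L G hG R => ?_⟩
  -- Without agents nobody reaches the root problem, but the claim on the agents is then vacuous and
  -- only an optimal solution is needed.
  rcases Nat.eq_zero_or_pos N with rfl | hN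
  · obtain ⟨z, hz⟩ := gap.exists_isOptimal hfeas
    exact ⟨0, z, _, hz, rfl, fun _ _ i => i.elim0⟩
  · refine (BnP.starts_zero hN gap R K L G).agreement hG (hK₀ K hK) hfeas
      ⟨Or.inl rfl, fun z _ => Or.inr ⟨rfl, ∅, Finset.mem_insert_self _ _, fun i m b h => ?_⟩⟩
    simp at h
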